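/- **Setting.** Let $f:\mathbb Z\to\mathbb R$ be a time series, $(X(t))$ real random variables and $(D(t))$ $\{0,1\}$-valued random variables; at time $t$ the value $X(t)$ is observed if $D(t)=1$ and is missing if $D(t)=0$. Let $L>1$, $T$ be integers, $N=\lfloor T/L\rfloor-1$, and assume $L\le N$. The $L\times N$ Page matrix of a series $x$ has entries $x(i+(j-1)L)$, $i\le L$, $j\le N$; let $\mathbf X$, $\mathbf D$, $\mathbf M$ be the Page matrices of $X$, $D$, $f$. Write $\|g\|_2^2=\sum_{t=1}^{LN}g(t)^2$ (the times covered by the Page matrix), and assume $\|f\|_2>0$. Let $\|\cdot\|$, $\|\cdot\|_F$, $\|\cdot\|_*$, $\|\cdot\|_{\max}$ be the spectral, Frobenius, nuclear and entrywise maximum norms, and $\|Z\|_{\psi_2}=\inf\{t>0:\mathbb E\exp(Z^2/t^2)\le 2\}$. **Imputability.** $f$ is $(r,\delta_1)$-imputable with noise level $\sigma$ and observation probability $p\in(0,1]$ if: (A) the pairs $(X_{ij},D_{ij})$ are independent over $(i,j)$, $X_{ij}$ is independent of $D_{ij}$, $\mathbb E X_{ij}=M_{ij}$, $\|X_{ij}\|_{\psi_2}\le\sigma$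 and $\mathbb P(D_{ij}=1)=p$; (B) $\delta_1\ge 0$ and there is a matrix $\mathbf M_{(r)}$ of rank at most $r$ with $\|\mathbf M-\mathbf M_{(r)}\|_{\max}\le\delta_1$. **Estimation property.** A matrix estimation algorithm $\mathrm{ME}$ maps a real $L\times N$ matrix with missing entries to a real $L\times N$ matrix. Let $\widehat{\mathbf M}$ be its output on the partially observed $\mathbf X$, let $Y_{ij}=X_{ij}$ if $X_{ij}$ is observed and $Y_{ij}=0$ otherwise, and let $\hat p=\max\{\frac1{LN}\#\{(i,j):X_{ij}\text{ observed}\},\frac1{LN}\}$. $\mathrm{ME}$ has the estimation property for this model with constants $C_0>0$ and $\zeta\in(0,1)$ if, whenever $p\ge\max(L,N)^{-1+\zeta}$, almost surely $$\|\hat p\,\widehat{\mathbf M}-p\mathbf M\|_F^2\le C_0\,\|\mathbf Y-p\mathbf M\|\,\|p\mathbf M\|_*.$$ The imputed series is $\hat f_I(i+(j-1)L)=\widehat M_{ij}$, and $\mathrm{MSE}(\hat f_I,f)=\mathbb E\|\hat f_I-f\|_2^2/\|f\|_2^2$. **Theorem.** For every $C_0>0$ there are constants $C_1,C_2,C_3,c_4>0$,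 depending only on $C_0$, such that the following holds in the above setting. If $f$ is $(r,\delta_1)$-imputable with noise level $\sigma$ and observation probability $p$, $\mathrm{ME}$ has the estimation property with constants $C_0$ and $\zeta\in(0,1)$, and $p\ge\max(L,N)^{-1+\zeta}$, then $$\mathrm{MSE}(\hat f_I,f)\le\frac{C_1\sigma}{p}\left(\frac{LN\delta_1}{\|f\|_2^2}+\frac{\sqrt{rL}\,N\delta_1}{\|f\|_2^2}+\frac{\sqrt{rN}}{\|f\|_2}\right)+\frac{C_2(1-p)}{pLN}+C_3e^{-c_4N}.$$ -/

import Mathlib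

open MeasureTheory ProbabilityTheory
open scoped ENNReal

/-! ### Matrix norms -/

/-- The squared Frobenius norm `∑ i, ∑ j, A i j ^ 2`. -/
def frobeniusSq {m n : ℕ} (A : Matrix (Fin m) (Fin n) ℝ) : ℝ :=
  ∑ i, ∑ j, A i j ^ 2

open scoped Matrix.Norms.L2Operator in
/-- The spectral norm: the norm of `A` as an operator between Euclidean spaces. -/
noncomputable def spectralNorm2 {m n : ℕ} (A : Matrix (Fin m) (Fin n) ℝ) : ℝ := ‖A‖

/-- The nuclear norm: the sum of the singular values, i.e. of the square roots of the
eigenvalues of `Aᴴ * A`, with multiplicity. -/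
noncomputable def nuclearNorm {m n : ℕ} (A : Matrix (Fin m) (Fin n) ℝ) : ℝ :=
  ∑ k, Real.sqrt ((Matrix.isHermitian_conjTranspose_mul_self A).eigenvalues k)

/-! ### Sub-gaussian norm -/

/-- The sub-gaussian norm `inf {t > 0 : 𝔼 exp (X ^ 2 / t ^ 2) ≤ 2}` of a real random variable,
equal to `∞` when there is no such `t`. -/
noncomputable def psi2Norm {Ω : Type*} [MeasurableSpace Ω] (P : Measure Ω) (X : Ω → ℝ) : ℝ≥0∞ :=
  ⨅ (t : ℝ) (_ : 0 < t) (_ : ∫⁻ ω, ENNReal.ofReal (Real.exp (X ω ^ 2 / t ^ 2)) ∂P ≤ 2),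
    ENNReal.ofReal t

/-! ### Partially observed matrices and matrix estimation -/

/-- A matrix estimation algorithm takes a noisy matrix, some of whose entries are missing
(`none`), and returns a real matrix. -/
abbrev MatrixEstimator (m n : ℕ) : Type :=
  Matrix (Fin m) (Fin n) (Option ℝ) → Matrix (Fin m) (Fin n) ℝ

/-- The zero-filled version `Y` of a partially observed matrix. -/
def zeroFill {m n : ℕ} (Z : Matrix (Fin m) (Fin n) (Option ℝ)) : Matrix (Fin m) (Fin n) ℝ :=
  Matrix.of fun i j => (Z i j).getD 0

/-- The observed proportion `p̂ = max (#observed / (m n), 1 / (m n))`. -/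
noncomputable def observedProportion {m n : ℕ} (Z : Matrix (Fin m) (Fin n) (Option ℝ)) : ℝ :=
  max ((∑ i, ∑ j, if (Z i j).isSome then (1 : ℝ) else 0) / ((m : ℝ) * n)) (1 / ((m : ℝ) * n))

/-- The estimation guarantee required of `ME` on the partially observed random matrix `Z`, with
signal matrix `M`, observation probability `p` and constants `C₀`, `ζ`: if
`p ≥ max (m, n) ^ (-1 + ζ)`, then almost surely
`‖p̂ M̂ - p M‖_F² ≤ C₀ ‖Y - p M‖ ‖p M‖_*` with `M̂ = ME Z`. -/
def EstimationGuarantee {Ω : Type*} [MeasurableSpace Ω] (P : Measure Ω) {m n : ℕ}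
    (ME : MatrixEstimator m n) (Z : Ω → Matrix (Fin m) (Fin n) (Option ℝ))
    (M : Matrix (Fin m) (Fin n) ℝ) (p C₀ ζ : ℝ) : Prop :=
  ((max m n : ℕ) : ℝ) ^ (-1 + ζ) ≤ p →
    ∀ᵐ ω ∂P, frobeniusSq (observedProportion (Z ω) • ME (Z ω) - p • M) ≤
      C₀ * spectralNorm2 (zeroFill (Z ω) - p • M) * nuclearNorm (p • M)

/-- The `(r, δ₁)`-imputability property of a random matrix `X` with observation indicators `D` and
mean matrix `M`: noise level `σ`, observation probability `p`. -/
structure IsImputable {Ω : Type*} [MeasurableSpace Ω] (P : Measure Ω) {m n : ℕ}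
    (X : Matrix (Fin m) (Fin n) (Ω → ℝ)) (D : Matrix (Fin m) (Fin n) (Ω → Bool))
    (M : Matrix (Fin m) (Fin n) ℝ) (σ p : ℝ) (r : ℕ) (δ₁ : ℝ) : Prop where
  measurable_entry : ∀ i j, Measurable (X i j)
  measurable_obs : ∀ i j, Measurable (D i j)
  /-- The pairs (entry, observation indicator) are independent over all positions. -/
  indep : iIndepFun (fun (q : Fin m × Fin n) ω => (X q.1 q.2 ω, D q.1 q.2 ω)) P
  /-- Whether an entry is observed does not depend on its value. -/
  indep_obs : ∀ i j, IndepFun (X i j) (D i j) P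
  mean_entry : ∀ i j, ∫ ω, X i j ω ∂P = M i j
  subgaussian : ∀ i j, psi2Norm P (X i j) ≤ ENNReal.ofReal σ
  p_pos : 0 < p
  p_le_one : p ≤ 1
  prob_obs : ∀ i j, P {ω | D i j ω = true} = ENNReal.ofReal p
  delta_nonneg : 0 ≤ δ₁
  low_rank : ∃ Mr : Matrix (Fin m) (Fin n) ℝ, Mr.rank ≤ r ∧ ∀ i j, |M i j - Mr i j| ≤ δ₁

/-! ### Time series, Page matrices and imputation -/

/-- The time `i + (j - 1) L` at the 1-based position `(i, j)`; `Fin` is 0-based. -/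
def pageTime {L N : ℕ} (i : Fin L) (j : Fin N) : ℤ :=
  ((i : ℕ) : ℤ) + ((j : ℕ) : ℤ) * (L : ℤ) + 1

/-- The `L × N` Page matrix of a series. -/
def pageMatrix {α : Type*} (L N : ℕ) (x : ℤ → α) : Matrix (Fin L) (Fin N) α :=
  Matrix.of fun i j => x (pageTime i j)

/-- The partially observed series: at time `t` the value `X t` is seen iff `D t` is true. -/
def observedSeries {Ω : Type*} (X : ℤ → Ω → ℝ) (D : ℤ → Ω → Bool) (ω : Ω) (t : ℤ) : Option ℝ :=
  if D t ω = true then some (X t ω) else none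

/-- The series whose value at time `pageTime i j` is `A i j`; it vanishes outside
`{1, …, L * N}`. At each time at most one term of the sum is nonzero. -/
def seriesOfPage {L N : ℕ} (A : Matrix (Fin L) (Fin N) ℝ) (t : ℤ) : ℝ :=
  ∑ i, ∑ j, if t = pageTime i j then A i j else 0

/-- The imputation algorithm: form the Page matrix of the observed series, apply `ME`, and read
the output as a series. -/
def imputedSeries {L N : ℕ} (ME : MatrixEstimator L N) (z : ℤ → Option ℝ) : ℤ → ℝ :=
  seriesOfPage (ME (pageMatrix L N z))

/-- `‖g‖₂²` over the times `1, …, L * N` covered by the Page matrix. -/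
noncomputable def seriesNormSq (L N : ℕ) (g : ℤ → ℝ) : ℝ :=
  ∑ t ∈ Finset.Icc (1 : ℤ) ((L : ℤ) * (N : ℤ)), g t ^ 2

/-- The relative mean-squared error `𝔼 ‖f̂ - f‖₂² / ‖f‖₂²` of a random series `fhat`, as an
extended nonnegative number. -/
noncomputable def relMSE {Ω : Type*} [MeasurableSpace Ω] (P : Measure Ω) (L N : ℕ)
    (fhat : Ω → ℤ → ℝ) (f : ℤ → ℝ) : ℝ≥0∞ :=
  (∫⁻ ω, ENNReal.ofReal (seriesNormSq L N (fun t => fhat ω t - f t)) ∂P) /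
    ENNReal.ofReal (seriesNormSq L N f)

/-!
The error of the estimator splits as `M̂ - M = p̂⁻¹ (p̂ M̂ - p M) + (p / p̂ - 1) M`, so

`‖M̂ - M‖_F² ≤ 2 C₀ p̂⁻² ‖Y - p M‖ ‖p M‖_* + 2 ((p - p̂) / p̂)² ‖M‖_F²`.

Three facts bound the expectation of the right-hand side.

* `p̂ = max (S, 1) / (L N)` with `S` binomial. Absorbing factors `1 / (k + 1)` into binomial
  coefficients (`binomMean_div_succ_mul_le`) gives `𝔼 p̂⁻⁴ ≤ 120 / p⁴` and
  `𝔼 ((p - p̂) / p̂)² ≤ 30 (1 - p) / (p L N)` as soon as `p L N ≥ 1`. No concentration inequality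
  for `p̂`, and so no exceptional event, is involved.
* `Y - p M` has independent centred sub-gaussian entries (`hasSubgaussianMGF_sub_integral`), and a
  union bound over nets of the two Euclidean balls gives `𝔼 ‖Y - p M‖² ≲ σ² N`
  (`integral_spectralNorm2_sq_le`).
* If `M` is within `δ₁` of `M_r`, of rank `r`, then `‖M‖_* ≤ √r ‖M_r‖_F + √L ‖M - M_r‖_F`
  (`nuclearNorm_le`), which is at most `√r ‖M‖_F + (√r + √L) √(L N) δ₁`.

The product `p̂⁻² ‖Y - p M‖` is separated by the inequality of arithmetic and geometric means
(`IsImputable.lintegral_frobeniusSq_sub_le`), and the Page matrix identifies `‖f‖₂` with `‖M‖_F`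
(`seriesNormSq_eq_frobeniusSq`).
-/

/-! ### Frobenius, nuclear and spectral norms -/

theorem frobeniusSq_nonneg {m n : ℕ} (A : Matrix (Fin m) (Fin n) ℝ) : 0 ≤ frobeniusSq A :=
  Finset.sum_nonneg fun _ _ => Finset.sum_nonneg fun _ _ => sq_nonneg _

theorem frobeniusSq_smul {m n : ℕ} (c : ℝ) (A : Matrix (Fin m) (Fin n) ℝ) :
    frobeniusSq (c • A) = c ^ 2 * frobeniusSq A := by
  simp [frobeniusSq, Finset.mul_sum, mul_pow]

theorem frobeniusSq_add_le {m n : ℕ} (A B : Matrix (Fin m) (Fin n) ℝ) :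
    frobeniusSq (A + B) ≤ 2 * frobeniusSq A + 2 * frobeniusSq B := by
  simp only [frobeniusSq, Finset.mul_sum, ← Finset.sum_add_distrib, Matrix.add_apply]
  gcongr with i _ j _
  nlinarith [sq_nonneg (A i j - B i j)]

theorem frobeniusSq_le_of_abs_le {m n : ℕ} {A : Matrix (Fin m) (Fin n) ℝ} {δ : ℝ}
    (h : ∀ i j, |A i j| ≤ δ) : frobeniusSq A ≤ m * n * δ ^ 2 := by
  calc frobeniusSq A ≤ ∑ _i : Fin m, ∑ _j : Fin n, δ ^ 2 := by
        unfold frobeniusSq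
        refine Finset.sum_le_sum fun i _ => Finset.sum_le_sum fun j _ => ?_
        exact sq_le_sq.2 ((h i j).trans (le_abs_self δ))
    _ = m * n * δ ^ 2 := by simp [mul_assoc]

theorem sqrt_frobeniusSq_sub_le {m n : ℕ} (A B : Matrix (Fin m) (Fin n) ℝ) :
    Real.sqrt (frobeniusSq (A - B)) ≤ Real.sqrt (frobeniusSq A) + Real.sqrt (frobeniusSq B) := by
  have key : ∀ C : Matrix (Fin m) (Fin n) ℝ, Real.sqrt (frobeniusSq C) =
      ‖(WithLp.toLp 2 fun q : Fin m × Fin n => C q.1 q.2 : EuclideanSpace ℝ (Fin m × Fin n))‖ := by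
    intro C
    rw [EuclideanSpace.norm_eq]
    simp [frobeniusSq, Fintype.sum_prod_type]
  rw [key, key, key]
  exact norm_sub_le (WithLp.toLp 2 fun q : Fin m × Fin n => A q.1 q.2 :
    EuclideanSpace ℝ (Fin m × Fin n)) (WithLp.toLp 2 fun q : Fin m × Fin n => B q.1 q.2)

theorem sum_norm_sq_toEuclideanLin {m n : ℕ} (B : Matrix (Fin m) (Fin n) ℝ)
    (b : OrthonormalBasis (Fin n) ℝ (EuclideanSpace ℝ (Fin n))) :
    ∑ k, ‖Matrix.toEuclideanLin B (b k)‖ ^ 2 = frobeniusSq B := by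
  have h : ∀ k i, Matrix.toEuclideanLin B (b k) i = inner ℝ (b k) (WithLp.toLp 2 (B i)) := by
    intro k i
    simp [Matrix.toLpLin_apply, Matrix.mulVec, PiLp.inner_apply, dotProduct]
  simp_rw [EuclideanSpace.norm_sq_eq, h]
  rw [Finset.sum_comm]
  simp_rw [b.sum_sq_norm_inner_right, EuclideanSpace.norm_sq_eq]
  simp [frobeniusSq]

/-- A form of the duality between nuclear and spectral norms: the pairing of `B` with a partial
isometry is at most `√(rank B) ‖B‖_F`. Only the projections of the `u k` to the range of `B`
matter, and by Bessel's inequality their squared lengths add up to at most `rank B`. -/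
theorem sum_inner_toEuclideanLin_le {m n : ℕ} (B : Matrix (Fin m) (Fin n) ℝ)
    (b : OrthonormalBasis (Fin n) ℝ (EuclideanSpace ℝ (Fin n))) (s : Finset (Fin n))
    (u : Fin n → EuclideanSpace ℝ (Fin m)) (hu : Orthonormal ℝ (fun k : s => u k)) :
    ∑ k ∈ s, inner ℝ (u k) (Matrix.toEuclideanLin B (b k)) ≤
      Real.sqrt B.rank * Real.sqrt (frobeniusSq B) := by
  set V := LinearMap.range (Matrix.toEuclideanLin B) with hV
  set e := stdOrthonormalBasis ℝ V
  have hrank : Module.finrank ℝ V = B.rank := by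
    rw [B.rank_eq_finrank_range_toLin (EuclideanSpace.basisFun (Fin m) ℝ).toBasis
      (EuclideanSpace.basisFun (Fin n) ℝ).toBasis, ← Matrix.toEuclideanLin_eq_toLin_orthonormal]
  have hproj : ∑ k ∈ s, ‖V.orthogonalProjectionOnto (u k)‖ ^ 2 ≤ B.rank := by
    calc ∑ k ∈ s, ‖V.orthogonalProjectionOnto (u k)‖ ^ 2
        = ∑ k ∈ s, ∑ l, ‖inner ℝ (u k) (e l : EuclideanSpace ℝ (Fin m))‖ ^ 2 := by
          refine Finset.sum_congr rfl fun k _ => ?_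
          rw [← e.sum_sq_norm_inner_left]
          refine Finset.sum_congr rfl fun l _ => ?_
          rw [Submodule.inner_orthogonalProjectionOnto_eq_of_mem_right]
      _ = ∑ l, ∑ k ∈ s, ‖inner ℝ (u k) (e l : EuclideanSpace ℝ (Fin m))‖ ^ 2 := Finset.sum_comm
      _ ≤ ∑ _l : Fin (Module.finrank ℝ V), (1 : ℝ) := by
          refine Finset.sum_le_sum fun l _ => ?_
          have := hu.sum_inner_products_le (s := Finset.univ) (e l : EuclideanSpace ℝ (Fin m))
          rw [Finset.univ_eq_attach, Finset.sum_attach s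
            (fun k => ‖inner ℝ (u k) (e l : EuclideanSpace ℝ (Fin m))‖ ^ 2)] at this
          refine this.trans ?_
          have h1 : ‖(e l : EuclideanSpace ℝ (Fin m))‖ = 1 := e.orthonormal.1 l
          simp [h1]
      _ = B.rank := by simp [hrank]
  calc ∑ k ∈ s, inner ℝ (u k) (Matrix.toEuclideanLin B (b k))
      ≤ ∑ k ∈ s, ‖V.orthogonalProjectionOnto (u k)‖ * ‖Matrix.toEuclideanLin B (b k)‖ := by
        refine Finset.sum_le_sum fun k _ => ?_
        have hmem : Matrix.toEuclideanLin B (b k) ∈ V := LinearMap.mem_range_self _ _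
        have := Submodule.inner_orthogonalProjectionOnto_eq_of_mem_right
          (K := V) ⟨_, hmem⟩ (u k)
        simp only at this
        rw [← this]
        exact real_inner_le_norm _ _
    _ ≤ Real.sqrt (∑ k ∈ s, ‖V.orthogonalProjectionOnto (u k)‖ ^ 2) *
        Real.sqrt (∑ k ∈ s, ‖Matrix.toEuclideanLin B (b k)‖ ^ 2) :=
        Real.sum_mul_le_sqrt_mul_sqrt _ _ _
    _ ≤ _ := by
        gcongr
        rw [← sum_norm_sq_toEuclideanLin B b]
        exact Finset.sum_le_univ_sum_of_nonneg fun _ => sq_nonneg _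

/-- With a singular value decomposition `A v_k = σ_k u_k`, the nuclear norm is
`∑ ⟪u_k, A v_k⟫ = ∑ ⟪u_k, B v_k⟫ + ∑ ⟪u_k, (A - B) v_k⟫`. -/
theorem nuclearNorm_le {m n : ℕ} (A B : Matrix (Fin m) (Fin n) ℝ) :
    nuclearNorm A ≤ Real.sqrt B.rank * Real.sqrt (frobeniusSq B) +
      Real.sqrt (A - B).rank * Real.sqrt (frobeniusSq (A - B)) := by
  classical
  set hH := Matrix.isHermitian_conjTranspose_mul_self A
  set b := hH.eigenvectorBasis
  set T := Matrix.toEuclideanLin A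
  have hinner : ∀ k l, inner ℝ (T (b k)) (T (b l)) = hH.eigenvalues l * inner ℝ (b k) (b l) := by
    intro k l
    have h1 := hH.mulVec_eigenvectorBasis l
    rw [← Matrix.mulVec_mulVec] at h1
    simp only [EuclideanSpace.inner_eq_star_dotProduct, T, Matrix.toLpLin_apply]
    rw [Matrix.star_mulVec, dotProduct_comm, ← Matrix.dotProduct_mulVec, h1]
    simp [dotProduct_comm, b]
  have hnorm : ∀ k, ‖T (b k)‖ ^ 2 = hH.eigenvalues k := by
    intro k
    rw [← real_inner_self_eq_norm_sq, hinner, real_inner_self_eq_norm_sq, b.orthonormal.1 k]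
    simp
  have hsqrt : ∀ k, Real.sqrt (hH.eigenvalues k) = ‖T (b k)‖ := fun k => by
    rw [← hnorm, Real.sqrt_sq (norm_nonneg _)]
  set s : Finset (Fin n) := Finset.univ.filter fun k => T (b k) ≠ 0
  set u : Fin n → EuclideanSpace ℝ (Fin m) := fun k => (‖T (b k)‖)⁻¹ • T (b k)
  have hs : ∀ k ∈ s, ‖T (b k)‖ ≠ 0 := fun k hk => norm_ne_zero_iff.2 (Finset.mem_filter.1 hk).2
  have hu : Orthonormal ℝ (fun k : s => u k) := by
    constructor
    · intro k
      have := hs k k.2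
      simp [u, norm_smul, this]
    · intro k l hkl
      have hkl' : (k : Fin n) ≠ l := fun h => hkl (Subtype.ext h)
      simp only [u, inner_smul_left, inner_smul_right, hinner, b.orthonormal.2 hkl']
      simp
  have hsplit : nuclearNorm A = ∑ k ∈ s, inner ℝ (u k) (Matrix.toEuclideanLin B (b k)) +
      ∑ k ∈ s, inner ℝ (u k) (Matrix.toEuclideanLin (A - B) (b k)) := by
    rw [← Finset.sum_add_distrib]
    have h1 : nuclearNorm A = ∑ k ∈ s, ‖T (b k)‖ := by
      have h2 : nuclearNorm A = ∑ k, ‖T (b k)‖ := Finset.sum_congr rfl fun k _ => hsqrt k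
      rw [h2]
      symm
      refine Finset.sum_subset (Finset.subset_univ _) fun k _ hk => ?_
      simpa [s] using hk
    rw [h1]
    refine Finset.sum_congr rfl fun k hk => ?_
    rw [← inner_add_right, ← LinearMap.add_apply, ← map_add, add_sub_cancel]
    change _ = inner ℝ (u k) (T (b k))
    simp only [u, inner_smul_left, real_inner_self_eq_norm_sq]
    have := hs k hk
    simp only [map_inv₀, conj_trivial]
    field_simp
  rw [hsplit]
  exact add_le_add (sum_inner_toEuclideanLin_le B b s u hu)
    (sum_inner_toEuclideanLin_le (A - B) b s u hu)

/-- A maximal `1`-separated subset of the ball of radius `2`. -/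
theorem exists_net (d : ℕ) : ∃ s : Finset (EuclideanSpace ℝ (Fin d)),
    s.card ≤ 5 ^ d ∧ (∀ c ∈ s, ‖c‖ ≤ 2) ∧ ∀ x : EuclideanSpace ℝ (Fin d), ‖x‖ ≤ 2 →
      ∃ c ∈ s, ‖x - c‖ ≤ 1 := by
  classical
  -- separated sets have at most `5 ^ d` points, so one of maximal cardinality exists
  let Q : ℕ → Prop := fun k => ∃ s : Finset (EuclideanSpace ℝ (Fin d)), s.card = k ∧
    (∀ c ∈ s, ‖c‖ ≤ 2) ∧ ∀ c ∈ s, ∀ e ∈ s, c ≠ e → 1 ≤ ‖c - e‖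
  have hbound : ∀ s : Finset (EuclideanSpace ℝ (Fin d)), (∀ c ∈ s, ‖c‖ ≤ 2) →
      (∀ c ∈ s, ∀ e ∈ s, c ≠ e → 1 ≤ ‖c - e‖) → s.card ≤ 5 ^ d := by
    intro s h1 h2
    simpa using Besicovitch.card_le_of_separated s h1 h2
  have hQ0 : Q 0 := ⟨∅, by simp⟩
  obtain ⟨s, hcard, hs, hsep⟩ : Q (Nat.findGreatest Q (5 ^ d)) :=
    Nat.findGreatest_spec (Nat.zero_le _) hQ0
  refine ⟨s, hbound s hs hsep, hs, fun x hx => ?_⟩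
  by_contra! hcon
  have hxs : x ∉ s := fun h => by
    have := hcon x h
    norm_num at this
  have h1 : ∀ c ∈ insert x s, ‖c‖ ≤ 2 := by
    intro c hc
    rcases Finset.mem_insert.1 hc with rfl | hc
    · exact hx
    · exact hs c hc
  have h2 : ∀ c ∈ insert x s, ∀ e ∈ insert x s, c ≠ e → 1 ≤ ‖c - e‖ := by
    intro c hc e he hce
    rcases Finset.mem_insert.1 hc with hcx | hc <;> rcases Finset.mem_insert.1 he with hex | he
    · exact absurd (hcx.trans hex.symm) hce
    · rw [hcx]; exact (hcon e he).le
    · rw [hex, norm_sub_rev]; exact (hcon c hc).le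
    · exact hsep c hc e he hce
  have h3 : Q (s.card + 1) := ⟨insert x s, Finset.card_insert_of_notMem hxs, h1, h2⟩
  have h4 := Nat.le_findGreatest
    (by simpa [Finset.card_insert_of_notMem hxs] using hbound _ h1 h2) h3
  omega

/-- The spectral norm is bounded by the bilinear form of `A` at some pair of points of two `1`-nets
of the balls of radius `2`. A vector of length `2` lies within `1` of a point of the net, so
passing to the net costs at most half of the norm, and the radius `2` makes up for this half. -/
theorem exists_spectralNorm2_le_inner {m n : ℕ} (A : Matrix (Fin m) (Fin n) ℝ)
    {s : Finset (EuclideanSpace ℝ (Fin m))} {t : Finset (EuclideanSpace ℝ (Fin n))}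
    (hs : ∀ x : EuclideanSpace ℝ (Fin m), ‖x‖ ≤ 2 → ∃ c ∈ s, ‖x - c‖ ≤ 1)
    (ht : ∀ x : EuclideanSpace ℝ (Fin n), ‖x‖ ≤ 2 → ∃ c ∈ t, ‖x - c‖ ≤ 1) :
    ∃ c ∈ s, ∃ d ∈ t, spectralNorm2 A ≤ ∑ i, ∑ j, c i * d j * A i j := by
  set T : EuclideanSpace ℝ (Fin n) →L[ℝ] EuclideanSpace ℝ (Fin m) :=
    LinearMap.toContinuousLinearMap (Matrix.toEuclideanLin A) with hT
  have hnorm : spectralNorm2 A = ‖T‖ := rfl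
  have htne : t.Nonempty := by
    obtain ⟨c, hc, -⟩ := ht 0 (by simp)
    exact ⟨c, hc⟩
  obtain ⟨d, hd, hmax⟩ := t.exists_max_image (fun d => ‖T d‖) htne
  have h1 : ‖T‖ ≤ ‖T d‖ := by
    -- a self-improving bound: `‖T‖` on the right is the cost of replacing `y` by the net
    have h2 : ‖T‖ ≤ (‖T d‖ + ‖T‖) / 2 := by
      refine T.opNorm_le_bound (by positivity) fun x => ?_
      rcases eq_or_ne x 0 with rfl | hx
      · simp
      have hx' : 0 < ‖x‖ := norm_pos_iff.2 hx
      set y := (2 / ‖x‖) • x with hy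
      obtain ⟨c, hc, hcy⟩ := ht y (by
        rw [hy, norm_smul, Real.norm_of_nonneg (by positivity)]
        field_simp; rfl)
      have h3 : ‖T y‖ ≤ ‖T d‖ + ‖T‖ := by
        calc ‖T y‖ = ‖T c + T (y - c)‖ := by rw [← map_add, add_sub_cancel]
          _ ≤ ‖T c‖ + ‖T (y - c)‖ := norm_add_le _ _
          _ ≤ ‖T d‖ + ‖T‖ * 1 := add_le_add (hmax c hc)
              ((T.le_opNorm _).trans (by gcongr))
          _ = _ := by ring
      have h4 : ‖T y‖ = 2 / ‖x‖ * ‖T x‖ := by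
        rw [hy, map_smul, norm_smul, Real.norm_of_nonneg (by positivity)]
      rw [h4, div_mul_eq_mul_div, div_le_iff₀ hx'] at h3
      linarith
    linarith
  set v := T d
  obtain ⟨c, hc, h5⟩ : ∃ c ∈ s, ‖v‖ ≤ inner ℝ c v := by
    rcases eq_or_ne v 0 with hv | hv
    · obtain ⟨c, hc, -⟩ := hs 0 (by simp)
      exact ⟨c, hc, by simp [hv]⟩
    have hv' : 0 < ‖v‖ := norm_pos_iff.2 hv
    obtain ⟨c, hc, hcy⟩ := hs ((2 / ‖v‖) • v) (by
        rw [norm_smul, Real.norm_of_nonneg (by positivity)]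
        field_simp; rfl)
    refine ⟨c, hc, ?_⟩
    have h6 : inner ℝ ((2 / ‖v‖) • v) v = 2 * ‖v‖ := by
      rw [inner_smul_left, real_inner_self_eq_norm_sq]
      simp only [conj_trivial]
      field_simp
    have h7 : inner ℝ ((2 / ‖v‖) • v - c) v ≤ ‖v‖ := (real_inner_le_norm _ _).trans
      (mul_le_of_le_one_left hv'.le hcy)
    rw [inner_sub_left, h6] at h7
    linarith
  refine ⟨c, hc, d, hd, ?_⟩
  rw [hnorm]
  refine h1.trans (h5.trans (le_of_eq ?_))
  simp only [PiLp.inner_apply, v, hT, LinearMap.coe_toContinuousLinearMap', Matrix.toLpLin_apply,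
    Matrix.mulVec, dotProduct, RCLike.inner_apply, conj_trivial, Finset.sum_mul]
  exact Finset.sum_congr rfl fun i _ => Finset.sum_congr rfl fun j _ => by ring

/-! ### Inverse moments of binomial variables -/

/-- The expectation of `g` under the binomial distribution with parameters `n` and `p`. -/
noncomputable def binomMean (n : ℕ) (p : ℝ) (g : ℕ → ℝ) : ℝ :=
  ∑ k ∈ Finset.range (n + 1), (n.choose k : ℝ) * p ^ k * (1 - p) ^ (n - k) * g k

theorem binomMean_mono {n : ℕ} {p : ℝ} (hp : 0 ≤ p) (hp1 : p ≤ 1) {g h : ℕ → ℝ}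
    (hgh : ∀ k, g k ≤ h k) : binomMean n p g ≤ binomMean n p h := by
  unfold binomMean
  have : 0 ≤ 1 - p := by linarith
  gcongr with k _
  exact hgh k

theorem binomMean_const_mul (n : ℕ) (p c : ℝ) (g : ℕ → ℝ) :
    binomMean n p (fun k => c * g k) = c * binomMean n p g := by
  simp only [binomMean, Finset.mul_sum]
  exact Finset.sum_congr rfl fun k _ => by ring

theorem binomMean_one (n : ℕ) (p : ℝ) : binomMean n p (fun _ => 1) = 1 := by
  have h := congrArg (Polynomial.eval p) (bernsteinPolynomial.sum ℝ n)
  simpa [bernsteinPolynomial, Polynomial.eval_finsetSum, binomMean] using h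

theorem binomMean_id (n : ℕ) (p : ℝ) : binomMean n p (fun k => k) = n * p := by
  have h := congrArg (Polynomial.eval p) (bernsteinPolynomial.sum_smul ℝ n)
  simp only [bernsteinPolynomial, Polynomial.eval_finsetSum] at h
  rw [binomMean]
  convert h using 1
  · refine Finset.sum_congr rfl fun k _ => ?_
    simp
    ring
  · simp

theorem binomMean_sq_sub (n : ℕ) (p : ℝ) :
    binomMean n p (fun k => ((k : ℝ) - n * p) ^ 2) = n * p * (1 - p) := by
  have h := congrArg (Polynomial.eval p) (bernsteinPolynomial.variance ℝ n)
  simp only [bernsteinPolynomial, Polynomial.eval_finsetSum] at h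
  rw [binomMean]
  convert h using 1
  · refine Finset.sum_congr rfl fun k _ => ?_
    simp
    ring
  · simp

theorem binomMean_sq_sub_add (n : ℕ) (p a : ℝ) :
    binomMean n p (fun k => ((k : ℝ) - n * p + a) ^ 2) = n * p * (1 - p) + a ^ 2 := by
  have h : binomMean n p (fun k => ((k : ℝ) - n * p + a) ^ 2) =
      binomMean n p (fun k => ((k : ℝ) - n * p) ^ 2) + 2 * a * binomMean n p (fun k => k) +
        (a ^ 2 - 2 * a * (n * p)) * binomMean n p (fun _ => 1) := by
    simp only [binomMean, Finset.mul_sum, ← Finset.sum_add_distrib]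
    exact Finset.sum_congr rfl fun k _ => by ring
  rw [h, binomMean_sq_sub, binomMean_id, binomMean_one]
  ring

theorem binomMean_nonneg {n : ℕ} {p : ℝ} (hp : 0 ≤ p) (hp1 : p ≤ 1) {g : ℕ → ℝ}
    (hg : ∀ k, 0 ≤ g k) : 0 ≤ binomMean n p g := by
  have hq : 0 ≤ 1 - p := by linarith
  exact Finset.sum_nonneg fun k _ => mul_nonneg (by positivity) (hg k)

/-- Absorbing a factor `1 / (k + 1)` raises the number of trials by one, because
`(n + 1) * n.choose k = (k + 1) * (n + 1).choose (k + 1)`. -/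
theorem binomMean_div_succ_mul_le {n : ℕ} {p s : ℝ} (hp : 0 ≤ p) (hp1 : p ≤ 1)
    (hs : s ≤ (n + 1) * p) {h : ℕ → ℝ} (hh : ∀ k, 0 ≤ h k) :
    binomMean n p (fun k => h (k + 1) / (k + 1)) * s ≤ binomMean (n + 1) p h := by
  have hq : 0 ≤ 1 - p := by linarith
  refine (mul_le_mul_of_nonneg_left hs (binomMean_nonneg hp hp1 fun k =>
    div_nonneg (hh _) (by positivity))).trans ?_
  rw [binomMean, binomMean, Finset.sum_range_succ' _ (n + 1), Finset.sum_mul]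
  refine le_add_of_le_of_nonneg (le_of_eq (Finset.sum_congr rfl fun k _ => ?_)) ?_
  · have h1 : ((n : ℝ) + 1) * n.choose k = (n + 1).choose (k + 1) * (k + 1) := by
      exact_mod_cast Nat.add_one_mul_choose_eq n k
    rw [Nat.add_sub_add_right, pow_succ]
    field_simp
    linear_combination (p * p ^ k * (1 - p) ^ (n - k) * h (k + 1)) * h1
  · have := hh 0
    positivity

/-- The `-4`th moment, with `0` replaced by `1` to keep it finite: `max (k, 1)⁴` is compared with
`(k + 1) (k + 2) (k + 3) (k + 4) / 120`, whose inverse is absorbed in four steps. -/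
theorem binomMean_inv_max_pow_four_le {n : ℕ} {p : ℝ} (hn : 0 < n) (hp : 0 < p) (hp1 : p ≤ 1) :
    binomMean n p (fun k => 1 / max (k : ℝ) 1 ^ 4) ≤ 120 / (n * p) ^ 4 := by
  set s : ℝ := n * p with hs
  have hspos : 0 < s := by positivity
  have h0 : binomMean n p (fun k => 1 / max (k : ℝ) 1 ^ 4) ≤
      120 * binomMean n p (fun k => 1 / (((k + 1 : ℕ) + 1 : ℝ) * ((k + 1 : ℕ) + 2) *
        ((k + 1 : ℕ) + 3)) / (k + 1)) := by
    rw [← binomMean_const_mul]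
    refine binomMean_mono hp.le hp1 fun k => ?_
    rcases Nat.eq_zero_or_pos k with rfl | hk
    · norm_num
    have hk' : (1 : ℝ) ≤ k := by exact_mod_cast hk
    rw [max_eq_left hk', div_div, mul_one_div, div_le_div_iff₀ (by positivity) (by positivity)]
    push_cast
    calc 1 * (((k : ℝ) + 1 + 1) * (k + 1 + 2) * (k + 1 + 3) * (k + 1))
        ≤ 1 * ((3 * k) * (4 * k) * (5 * k) * (2 * k)) := by gcongr <;> linarith
      _ = 120 * (k : ℝ) ^ 4 := by ring
  have h1 := binomMean_div_succ_mul_le (n := n) (s := s) hp.le hp1 (by rw [hs]; gcongr; linarith)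
    (h := fun j => 1 / (((j : ℝ) + 1) * (j + 2) * (j + 3))) (fun k => by positivity)
  have h2 := binomMean_div_succ_mul_le (n := n + 1) (s := s) hp.le hp1
    (by rw [hs]; gcongr; push_cast; linarith)
    (h := fun j => 1 / (((j : ℝ) + 1) * (j + 2))) (fun k => by positivity)
  have h3 := binomMean_div_succ_mul_le (n := n + 2) (s := s) hp.le hp1
    (by rw [hs]; gcongr; push_cast; linarith)
    (h := fun j => 1 / ((j : ℝ) + 1)) (fun k => by positivity)
  have h4 := binomMean_div_succ_mul_le (n := n + 3) (s := s) hp.le hp1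
    (by rw [hs]; gcongr; push_cast; linarith) (h := fun _ => 1) (fun k => zero_le_one)
  have e2 : binomMean (n + 1) p (fun j => 1 / (((j : ℝ) + 1) * (j + 2) * (j + 3))) =
      binomMean (n + 1) p (fun j => 1 / (((j + 1 : ℕ) + 1 : ℝ) * ((j + 1 : ℕ) + 2)) / (j + 1)) := by
    congr 1; ext j; push_cast; field_simp; ring
  have e3 : binomMean (n + 2) p (fun j => 1 / (((j : ℝ) + 1) * (j + 2))) =
      binomMean (n + 2) p (fun j => 1 / ((j + 1 : ℕ) + 1 : ℝ) / (j + 1)) := by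
    congr 1; ext j; push_cast; field_simp; ring
  rw [← e2] at h2
  rw [← e3] at h3
  rw [binomMean_one] at h4
  rw [le_div_iff₀ (by positivity)]
  refine (mul_le_mul_of_nonneg_right h0 (by positivity)).trans ?_
  have h12 := (mul_le_mul_of_nonneg_right h1 hspos.le).trans h2
  have h13 := (mul_le_mul_of_nonneg_right h12 hspos.le).trans h3
  have h14 := (mul_le_mul_of_nonneg_right h13 hspos.le).trans h4
  linarith

/-- Here `max (k, 1)²` is compared with `(k + 1) (k + 2) / 6`. Absorbing the inverse turns the mean
into a second moment of the binomial distribution with `n + 2` trials, which keeps the factor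
`1 - p`. -/
theorem binomMean_relative_error_le {n : ℕ} {p : ℝ} (hp : 0 < p) (hp1 : p ≤ 1)
    (hnp : 1 ≤ n * p) :
    binomMean n p (fun k => ((n * p - max (k : ℝ) 1) / max (k : ℝ) 1) ^ 2) ≤
      30 * (1 - p) / (n * p) := by
  set s : ℝ := n * p with hs
  have hspos : 0 < s := by linarith
  have h0 : binomMean n p (fun k => ((s - max (k : ℝ) 1) / max (k : ℝ) 1) ^ 2) ≤
      6 * binomMean n p (fun k => (((k + 1 : ℕ) : ℝ) - 1 - s) ^ 2 / ((k + 1 : ℕ) + 1) /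
        (k + 1)) := by
    rw [← binomMean_const_mul]
    refine binomMean_mono hp.le hp1 fun k => ?_
    rcases Nat.eq_zero_or_pos k with rfl | hk
    · norm_num
      nlinarith
    have hk' : (1 : ℝ) ≤ k := by exact_mod_cast hk
    rw [max_eq_left hk', div_div, mul_div_assoc', div_pow,
      div_le_div_iff₀ (by positivity) (by positivity)]
    push_cast
    calc (s - (k : ℝ)) ^ 2 * ((k + 1 + 1) * (k + 1))
        ≤ (s - (k : ℝ)) ^ 2 * ((3 * k) * (2 * k)) := by gcongr <;> linarith
      _ = 6 * ((k : ℝ) + 1 - 1 - s) ^ 2 * (k : ℝ) ^ 2 := by ring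
  have h1 := binomMean_div_succ_mul_le (n := n) (s := s) hp.le hp1 (by rw [hs]; gcongr; linarith)
    (h := fun j => ((j : ℝ) - 1 - s) ^ 2 / (j + 1)) (fun k => by positivity)
  have h2 := binomMean_div_succ_mul_le (n := n + 1) (s := s) hp.le hp1
    (by rw [hs]; gcongr; push_cast; linarith)
    (h := fun j => ((j : ℝ) - 2 - s) ^ 2) (fun k => by positivity)
  have e2 : binomMean (n + 1) p (fun j => ((j : ℝ) - 1 - s) ^ 2 / (j + 1)) =
      binomMean (n + 1) p (fun j => (((j + 1 : ℕ) : ℝ) - 2 - s) ^ 2 / (j + 1)) := by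
    congr 1; ext j; push_cast; congr 2; ring
  have e3 : binomMean (n + 2) p (fun j => ((j : ℝ) - 2 - s) ^ 2) =
      (n + 2) * p * (1 - p) + (2 * p - 2) ^ 2 := by
    have := binomMean_sq_sub_add (n + 2) p (2 * p - 2)
    push_cast at this
    rw [← this]
    congr 1; ext j; rw [hs]; ring
  rw [← e2] at h2
  have h12 := (mul_le_mul_of_nonneg_right h1 hspos.le).trans (h2.trans_eq e3)
  have hfin : ((n : ℝ) + 2) * p * (1 - p) + (2 * p - 2) ^ 2 ≤ 5 * (1 - p) * s := by
    have : ((n : ℝ) + 2) * p * (1 - p) + (2 * p - 2) ^ 2 = (1 - p) * (s + 4 - 2 * p) := by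
      rw [hs]; ring
    rw [this]
    nlinarith [mul_nonneg (sub_nonneg.2 hp1) (by linarith : 0 ≤ 4 * s - 4 + 2 * p)]
  rw [le_div_iff₀ hspos]
  refine (mul_le_mul_of_nonneg_right h0 hspos.le).trans ?_
  have h13 := h12.trans hfin
  have h14 := le_of_mul_le_mul_right h13 hspos
  linarith

/-- The number of successes in independent Bernoulli trials has the binomial distribution. -/
theorem integral_card_filter_eq_binomMean {Ω ι : Type*} [MeasurableSpace Ω] {P : Measure Ω}
    [IsProbabilityMeasure P] [Fintype ι] {D : ι → Ω → Bool} (hD : ∀ i, Measurable (D i))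
    (hind : iIndepFun D P) {p : ℝ} (hp : 0 ≤ p) (hDp : ∀ i, P {ω | D i ω = true} = ENNReal.ofReal p)
    (g : ℕ → ℝ) :
    ∫ ω, g (Finset.univ.filter fun i => D i ω = true).card ∂P =
      binomMean (Fintype.card ι) p g := by
  classical
  set E : Finset ι → Set Ω := fun A => ⋂ i ∈ (Finset.univ : Finset ι), D i ⁻¹' {decide (i ∈ A)}
  have hE : ∀ A, MeasurableSet (E A) := fun A =>
    Finset.measurableSet_biInter _ fun i _ => hD i (measurableSet_singleton _)
  have hmem : ∀ A ω, ω ∈ E A ↔ (Finset.univ.filter fun i => D i ω = true) = A := by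
    intro A ω
    simp only [E, Set.mem_iInter, Set.mem_preimage, Set.mem_singleton_iff, Finset.mem_univ,
      true_imp_iff, Finset.ext_iff, Finset.mem_filter, true_and]
    refine forall_congr' fun i => ?_
    by_cases h : i ∈ A <;> simp [h]
  have htrue : ∀ i, P.real (D i ⁻¹' {true}) = p := fun i => by
    rw [measureReal_def, show D i ⁻¹' {true} = {ω | D i ω = true} from rfl, hDp,
      ENNReal.toReal_ofReal hp]
  have hfalse : ∀ i, P.real (D i ⁻¹' {false}) = 1 - p := fun i => by
    rw [← htrue i, ← probReal_compl_eq_one_sub (hD i (measurableSet_singleton _))]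
    congr 1
    ext ω
    simp
  have hprob : ∀ A, P.real (E A) = p ^ A.card * (1 - p) ^ (Fintype.card ι - A.card) := by
    intro A
    rw [measureReal_def, hind.measure_inter_preimage_eq_mul _ fun i _ => measurableSet_singleton _,
      ENNReal.toReal_prod]
    have : ∀ i, (P (D i ⁻¹' {decide (i ∈ A)})).toReal = if i ∈ A then p else 1 - p := by
      intro i
      by_cases h : i ∈ A
      · simpa [h, measureReal_def] using htrue i
      · simpa [h, measureReal_def] using hfalse i
    simp_rw [this]
    rw [Finset.prod_ite, Finset.prod_const, Finset.prod_const, Finset.filter_univ_mem,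
      Finset.filter_not, Finset.filter_univ_mem, ← Finset.compl_eq_univ_sdiff, Finset.card_compl]
  have hsum : ∀ ω, g (Finset.univ.filter fun i => D i ω = true).card =
      ∑ A : Finset ι, (E A).indicator (fun _ => g A.card) ω := by
    intro ω
    rw [Finset.sum_eq_single (Finset.univ.filter fun i => D i ω = true)]
    · rw [Set.indicator_of_mem ((hmem _ _).2 rfl)]
    · intro A _ hA
      rw [Set.indicator_of_notMem fun h => hA ((hmem _ _).1 h).symm]
    · simp
  simp_rw [hsum]
  rw [integral_finsetSum _ fun A _ => (integrable_const _).indicator (hE A)]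
  simp_rw [integral_indicator_const _ (hE _), hprob, smul_eq_mul]
  have := Finset.sum_powerset_apply_card
    (fun k => p ^ k * (1 - p) ^ (Fintype.card ι - k) * g k) (x := (Finset.univ : Finset ι))
  rw [Finset.powerset_univ] at this
  rw [this, binomMean, Finset.card_univ]
  exact Finset.sum_congr rfl fun k _ => by rw [nsmul_eq_mul]; ring

/-! ### The spectral norm of a matrix with independent sub-gaussian entries -/

open scoped Matrix.Norms.L2Operator in
theorem continuous_spectralNorm2 {m n : ℕ} : Continuous (spectralNorm2 (m := m) (n := n)) :=
  continuous_norm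

open scoped Matrix.Norms.L2Operator in
theorem spectralNorm2_nonneg {m n : ℕ} (A : Matrix (Fin m) (Fin n) ℝ) : 0 ≤ spectralNorm2 A :=
  norm_nonneg A

theorem measurable_spectralNorm2 {Ω : Type*} [MeasurableSpace Ω] {m n : ℕ}
    {A : Ω → Matrix (Fin m) (Fin n) ℝ} (hA : ∀ i j, Measurable fun ω => A ω i j) :
    Measurable fun ω => spectralNorm2 (A ω) := by
  have h : Continuous (fun B : Fin m → Fin n → ℝ => spectralNorm2 (Matrix.of B)) :=
    continuous_spectralNorm2
  exact h.measurable.comp (measurable_pi_lambda _ fun i => measurable_pi_lambda _ fun j => hA i j)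

theorem exp_le_add_exp_sq (x : ℝ) : Real.exp x ≤ x + Real.exp (x ^ 2) := by
  rcases le_total |x| 1 with h | h
  · have h1 := (abs_le.1 (Real.abs_exp_sub_one_sub_id_le h)).2
    linarith [Real.add_one_le_exp (x ^ 2)]
  · rcases le_abs'.1 h with h | h
    · have h1 : Real.exp x ≤ 1 := Real.exp_le_one_iff.2 (by linarith)
      nlinarith [Real.add_one_le_exp (x ^ 2)]
    · have h1 : Real.exp x ≤ Real.exp (x ^ 2) := Real.exp_le_exp.2 (by nlinarith)
      linarith

theorem exp_mul_le (u v : ℝ) (hu : 0 ≤ u) (hu1 : u ≤ 1) :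
    Real.exp (u * v) ≤ 1 - u + u * Real.exp v := by
  have := convexOn_exp.2 (Set.mem_univ 0) (Set.mem_univ v) (sub_nonneg.2 hu1) hu (by ring)
  simpa using this

theorem lintegral_exp_le_two_of_psi2Norm_le {Ω : Type*} [MeasurableSpace Ω] {P : Measure Ω}
    {X : Ω → ℝ} {σ t : ℝ} (h : psi2Norm P X ≤ ENNReal.ofReal σ) (ht : 0 < t) (hσt : σ < t) :
    ∫⁻ ω, ENNReal.ofReal (Real.exp (X ω ^ 2 / t ^ 2)) ∂P ≤ 2 := by
  have h1 : psi2Norm P X < ENNReal.ofReal t := h.trans_lt ((ENNReal.ofReal_lt_ofReal_iff ht).2 hσt)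
  simp only [psi2Norm, iInf_lt_iff] at h1
  obtain ⟨s, hs, h2, h3⟩ := h1
  refine (lintegral_mono fun ω => ?_).trans h2
  have : s ≤ t := ((ENNReal.ofReal_lt_ofReal_iff ht).1 h3).le
  gcongr

theorem integrable_exp_sq_div {Ω : Type*} [MeasurableSpace Ω] {P : Measure Ω}
    {X V : Ω → ℝ} (hV : Measurable V) (hVX : ∀ ω, V ω ^ 2 ≤ X ω ^ 2) {t : ℝ}
    (hX : ∫⁻ ω, ENNReal.ofReal (Real.exp (X ω ^ 2 / t ^ 2)) ∂P ≤ 2) :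
    Integrable (fun ω => Real.exp (V ω ^ 2 / t ^ 2)) P ∧
      ∫ ω, Real.exp (V ω ^ 2 / t ^ 2) ∂P ≤ 2 := by
  set e : Ω → ℝ := fun ω => Real.exp (V ω ^ 2 / t ^ 2) with he
  have hemeas : Measurable e := by fun_prop
  have hle : ∫⁻ ω, ENNReal.ofReal (e ω) ∂P ≤ 2 := by
    refine (lintegral_mono fun ω => ?_).trans hX
    have := hVX ω
    simp only [he]
    gcongr
  constructor
  · refine ⟨hemeas.aestronglyMeasurable, ?_⟩
    rw [hasFiniteIntegral_iff_ofReal (ae_of_all _ fun ω => (Real.exp_pos _).le)]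
    exact hle.trans_lt (by simp)
  · rw [integral_eq_lintegral_of_nonneg_ae (ae_of_all _ fun ω => (Real.exp_pos _).le)
      hemeas.aestronglyMeasurable]
    exact ENNReal.toReal_le_of_le_ofReal (by norm_num) (by simpa using hle)

theorem memLp_two_and_sq_integral_le {Ω : Type*} [MeasurableSpace Ω] {P : Measure Ω}
    [IsProbabilityMeasure P] {V : Ω → ℝ} (hV : Measurable V) {t : ℝ} (ht : 0 < t)
    (heint : Integrable (fun ω => Real.exp (V ω ^ 2 / t ^ 2)) P)
    (he2 : ∫ ω, Real.exp (V ω ^ 2 / t ^ 2) ∂P ≤ 2) :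
    MemLp V 2 P ∧ (∫ ω, V ω ∂P) ^ 2 ≤ t ^ 2 := by
  set e : Ω → ℝ := fun ω => Real.exp (V ω ^ 2 / t ^ 2) with he
  have hsq : ∀ ω, V ω ^ 2 ≤ t ^ 2 * (e ω - 1) := by
    intro ω
    have := Real.add_one_le_exp (V ω ^ 2 / t ^ 2)
    calc V ω ^ 2 = t ^ 2 * (V ω ^ 2 / t ^ 2) := by field_simp
      _ ≤ _ := by gcongr; simp only [he]; linarith
  have hmemLp : MemLp V 2 P := by
    rw [memLp_two_iff_integrable_sq hV.aestronglyMeasurable]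
    refine ((heint.sub (integrable_const 1)).const_mul (t ^ 2)).mono'
      (hV.pow_const 2).aestronglyMeasurable (ae_of_all _ fun ω => ?_)
    rw [Real.norm_of_nonneg (sq_nonneg _)]
    exact hsq ω
  refine ⟨hmemLp, ?_⟩
  set μ := ∫ ω, V ω ∂P
  have h1 : μ ^ 2 ≤ ∫ ω, V ω ^ 2 ∂P := by
    have h2 := variance_nonneg V P
    rw [variance_eq_sub hmemLp] at h2
    simpa using h2
  refine h1.trans ((integral_mono hmemLp.integrable_sq
    ((heint.sub (integrable_const 1)).const_mul (t ^ 2)) hsq).trans ?_)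
  rw [integral_const_mul]
  simp only [Pi.sub_apply]
  rw [integral_sub heint (integrable_const 1)]
  simp only [integral_const, probReal_univ, one_smul]
  nlinarith [sq_nonneg t]

/-- Sub-gaussianity passes to a centred variable dominated by `|X|`, at the cost of a constant.
For `λ` with `2 λ² t² ≤ 1` the bound comes from `eˣ ≤ x + e^{x²}`, where the linear term has mean
zero; for larger `λ` it comes from `λ z ≤ λ² t² / 2 + z² / (2 t²)`. -/
theorem hasSubgaussianMGF_sub_integral {Ω : Type*} [MeasurableSpace Ω] {P : Measure Ω}
    [IsProbabilityMeasure P] {X V : Ω → ℝ} (hV : Measurable V)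
    (hVX : ∀ ω, V ω ^ 2 ≤ X ω ^ 2) {t : ℝ} (ht : 0 < t)
    (hX : ∫⁻ ω, ENNReal.ofReal (Real.exp (X ω ^ 2 / t ^ 2)) ∂P ≤ 2) :
    HasSubgaussianMGF (fun ω => V ω - ∫ ω, V ω ∂P) (Real.toNNReal (10 * t ^ 2)) P := by
  obtain ⟨heint, he2⟩ := integrable_exp_sq_div hV hVX hX
  obtain ⟨hmemLp, hμ2⟩ := memLp_two_and_sq_integral_le hV ht heint he2
  set e : Ω → ℝ := fun ω => Real.exp (V ω ^ 2 / t ^ 2) with he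
  have hVint : Integrable V P := hmemLp.integrable (by norm_num)
  set μ := ∫ ω, V ω ∂P with hμ
  have hlarge : ∀ (l : ℝ) ω, Real.exp (l * (V ω - μ)) ≤
      Real.exp (l ^ 2 * t ^ 2 / 2 + 1) * e ω := by
    intro l ω
    simp only [he]
    rw [← Real.exp_add, Real.exp_le_exp]
    have h1 : l * (V ω - μ) ≤ l ^ 2 * t ^ 2 / 2 + (V ω - μ) ^ 2 / (2 * t ^ 2) := by
      have h2 : 0 ≤ (l * t - (V ω - μ) / t) ^ 2 / 2 := by positivity
      have h3 : (l * t - (V ω - μ) / t) ^ 2 / 2 =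
          l ^ 2 * t ^ 2 / 2 + (V ω - μ) ^ 2 / (2 * t ^ 2) - l * (V ω - μ) := by
        field_simp
        ring
      linarith
    have h4 : (V ω - μ) ^ 2 / (2 * t ^ 2) ≤ 1 + V ω ^ 2 / t ^ 2 := by
      rw [div_le_iff₀ (by positivity)]
      have h5 : (1 + V ω ^ 2 / t ^ 2) * (2 * t ^ 2) = 2 * t ^ 2 + 2 * V ω ^ 2 := by
        field_simp
      rw [h5]
      nlinarith [sq_nonneg (V ω + μ)]
    linarith
  have hint : ∀ l : ℝ, Integrable (fun ω => Real.exp (l * (V ω - μ))) P := by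
    intro l
    refine (heint.const_mul (Real.exp (l ^ 2 * t ^ 2 / 2 + 1))).mono'
      (by fun_prop) (ae_of_all _ fun ω => ?_)
    rw [Real.norm_of_nonneg (Real.exp_pos _).le]
    exact hlarge l ω
  refine ⟨hint, fun l => ?_⟩
  rw [Real.coe_toNNReal _ (by positivity), mgf]
  set u := 2 * l ^ 2 * t ^ 2 with hu
  have hu0 : 0 ≤ u := by positivity
  have hgoal : 10 * t ^ 2 * l ^ 2 / 2 = 5 / 2 * u := by rw [hu]; ring
  rw [hgoal]
  rcases le_total u 1 with hu1 | hu1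
  · -- the factor `exp (u v)` with `u ≤ 1` is replaced by its chord, whose mean is at most `1 + u`
    have hsmall : ∀ ω, Real.exp (l * (V ω - μ)) ≤
        l * (V ω - μ) + Real.exp u * (1 - u + u * e ω) := by
      intro ω
      refine (exp_le_add_exp_sq _).trans ?_
      gcongr
      calc Real.exp ((l * (V ω - μ)) ^ 2) ≤ Real.exp (u + u * (V ω ^ 2 / t ^ 2)) := by
            rw [Real.exp_le_exp]
            have h1 : u + u * (V ω ^ 2 / t ^ 2) = l ^ 2 * (2 * t ^ 2 + 2 * V ω ^ 2) := by
              rw [hu]; field_simp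
            rw [h1, mul_pow]
            gcongr
            nlinarith [sq_nonneg (V ω + μ)]
        _ ≤ _ := by
            rw [Real.exp_add]
            gcongr
            exact exp_mul_le u _ hu0 hu1
    have hi1 : Integrable (fun ω => l * (V ω - μ)) P :=
      (hVint.sub (integrable_const μ)).const_mul l
    have hi2 : Integrable (fun ω => 1 - u + u * e ω) P :=
      (integrable_const _).add (heint.const_mul u)
    refine (integral_mono (hint l) (hi1.add (hi2.const_mul (Real.exp u))) hsmall).trans ?_
    simp only [Pi.add_apply]
    rw [integral_add hi1 (hi2.const_mul _), integral_const_mul, integral_const_mul,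
      integral_sub hVint (integrable_const _), integral_add (integrable_const _)
      (heint.const_mul u), integral_const_mul]
    simp only [integral_const, probReal_univ, one_smul, ← hμ, sub_self, mul_zero, zero_add]
    calc Real.exp u * (1 - u + u * ∫ ω, e ω ∂P) ≤ Real.exp u * (1 - u + u * 2) := by gcongr
      _ ≤ Real.exp u * Real.exp u := by gcongr; linarith [Real.add_one_le_exp u]
      _ = Real.exp (2 * u) := by rw [← Real.exp_add]; ring_nf
      _ ≤ Real.exp (5 / 2 * u) := by gcongr; norm_num
  · refine (integral_mono (hint l) (heint.const_mul _) (hlarge l)).trans ?_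
    rw [integral_const_mul]
    calc Real.exp (l ^ 2 * t ^ 2 / 2 + 1) * ∫ ω, e ω ∂P
        ≤ Real.exp (l ^ 2 * t ^ 2 / 2 + 1) * Real.exp 1 := by
          gcongr
          linarith [Real.add_one_le_exp 1]
      _ = Real.exp (u / 4 + 2) := by rw [← Real.exp_add, hu]; ring_nf
      _ ≤ Real.exp (5 / 2 * u) := by rw [Real.exp_le_exp]; linarith

/-- The moment generating function of the bilinear form `∑ c i d j A i j` on the balls of
radius `2`. -/
theorem integral_exp_bilinear_le {Ω : Type*} [MeasurableSpace Ω] {P : Measure Ω} {m n : ℕ}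
    {A : Ω → Matrix (Fin m) (Fin n) ℝ}
    (hind : iIndepFun (fun (q : Fin m × Fin n) ω => A ω q.1 q.2) P) {t : ℝ}
    (hsub : ∀ i j, HasSubgaussianMGF (fun ω => A ω i j) (Real.toNNReal (10 * t ^ 2)) P)
    {c : EuclideanSpace ℝ (Fin m)} {d : EuclideanSpace ℝ (Fin n)} (hc : ‖c‖ ≤ 2) (hd : ‖d‖ ≤ 2)
    (l : ℝ) :
    Integrable (fun ω => Real.exp (l * ∑ i, ∑ j, c i * d j * A ω i j)) P ∧
      ∫ ω, Real.exp (l * ∑ i, ∑ j, c i * d j * A ω i j) ∂P ≤ Real.exp (80 * t ^ 2 * l ^ 2) := by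
  have h1 : iIndepFun (fun (q : Fin m × Fin n) ω => c q.1 * d q.2 * A ω q.1 q.2) P :=
    hind.comp (fun q x => c q.1 * d q.2 * x) fun q => by fun_prop
  have hterm : ∀ q : Fin m × Fin n, HasSubgaussianMGF (fun ω => c q.1 * d q.2 * A ω q.1 q.2)
      (Real.toNNReal ((c q.1 * d q.2) ^ 2 * (10 * t ^ 2))) P := by
    intro q
    have h := (hsub q.1 q.2).const_mul (c q.1 * d q.2)
    rw [Real.toNNReal_mul (sq_nonneg _), Real.toNNReal_of_nonneg (sq_nonneg _)]
    exact h
  have h2 := HasSubgaussianMGF.sum_of_iIndepFun h1 (s := Finset.univ) fun q _ => hterm q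
  simp only [Fintype.sum_prod_type] at h2
  refine ⟨h2.integrable_exp_mul l, (h2.mgf_le l).trans (Real.exp_le_exp.2 ?_)⟩
  have h3 : ∑ i, ∑ j, (c i * d j) ^ 2 * (10 * t ^ 2) = ‖c‖ ^ 2 * ‖d‖ ^ 2 * (10 * t ^ 2) := by
    rw [EuclideanSpace.real_norm_sq_eq, EuclideanSpace.real_norm_sq_eq, Finset.sum_mul_sum,
      Finset.sum_mul]
    simp_rw [Finset.sum_mul, mul_pow]
  have h4 : ‖c‖ ^ 2 * ‖d‖ ^ 2 ≤ 2 ^ 2 * 2 ^ 2 := by gcongr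
  have h5 : ∀ i j, ((Real.toNNReal ((c i * d j) ^ 2 * (10 * t ^ 2)) : NNReal) : ℝ) =
      (c i * d j) ^ 2 * (10 * t ^ 2) := fun i j => Real.coe_toNNReal _ (by positivity)
  push_cast
  simp_rw [h5]
  rw [h3]
  nlinarith [mul_nonneg (sq_nonneg t) (sq_nonneg l)]

/-- Turns a bound on `𝔼 exp (x - a)` into one on `𝔼 x²` that is of the right order `a²`. -/
theorem sq_le_sq_add_exp {a x : ℝ} (ha : 1 ≤ a) (hx : 0 ≤ x) :
    x ^ 2 ≤ a ^ 2 + 4 * a * Real.exp (x - a) := by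
  rcases le_total x a with h | h
  · have := Real.exp_pos (x - a)
    nlinarith
  · have h1 := Real.add_one_le_exp (x - a)
    have h2 := Real.quadratic_le_exp_of_nonneg (sub_nonneg.2 h)
    nlinarith [Real.exp_pos (x - a)]

/-- The spectral norm of a matrix with independent centred sub-gaussian entries has second moment
of order `σ² n`. The `25ⁿ ≤ e^{4 n}` pairs of net points contribute at most `e^{320 n}` each to the
exponential moment, hence the constant `324`. The parameter `10 (2 σ)²` is the one that
`hasSubgaussianMGF_sub_integral` gives for entries of sub-gaussian norm at most `σ`: an infimum
need not be attained, so `σ` is replaced by `2 σ`. -/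
theorem integral_spectralNorm2_sq_le {Ω : Type*} [MeasurableSpace Ω] {P : Measure Ω}
    [IsProbabilityMeasure P] {m n : ℕ} (hmn : m ≤ n) (hn : 0 < n)
    {A : Ω → Matrix (Fin m) (Fin n) ℝ} (hA : ∀ i j, Measurable fun ω => A ω i j)
    (hind : iIndepFun (fun (q : Fin m × Fin n) ω => A ω q.1 q.2) P) {σ : ℝ} (hσ : 0 < σ)
    (hsub : ∀ i j, HasSubgaussianMGF (fun ω => A ω i j) (Real.toNNReal (10 * (2 * σ) ^ 2)) P) :
    Integrable (fun ω => spectralNorm2 (A ω) ^ 2) P ∧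
      ∫ ω, spectralNorm2 (A ω) ^ 2 ∂P ≤ 5 * 324 ^ 2 * σ ^ 2 * n := by
  obtain ⟨s, hscard, hs2, hs⟩ := exists_net m
  obtain ⟨t, htcard, ht2, ht⟩ := exists_net n
  have hn1 : (1 : ℝ) ≤ n := by exact_mod_cast hn
  -- the exponent that balances the entropy of the nets, of order `n`, with `320 σ² l²`
  set l : ℝ := Real.sqrt n / σ with hl
  have hlpos : 0 < l := by positivity
  have hl2 : l ^ 2 * σ ^ 2 = n := by
    rw [hl, div_pow, Real.sq_sqrt (by positivity)]
    field_simp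
  set a : ℝ := 324 * n with ha
  have hW0 : ∀ ω, 0 ≤ spectralNorm2 (A ω) := fun ω => spectralNorm2_nonneg _
  have hWmeas : Measurable fun ω => spectralNorm2 (A ω) := measurable_spectralNorm2 hA
  set F : Ω → ℝ := fun ω => ∑ c ∈ s, ∑ d ∈ t, Real.exp (l * ∑ i, ∑ j, c i * d j * A ω i j) with hF
  have hexp : ∀ ω, Real.exp (l * spectralNorm2 (A ω)) ≤ F ω := by
    intro ω
    obtain ⟨c, hc, d, hd, h⟩ := exists_spectralNorm2_le_inner (A ω) hs ht
    calc Real.exp (l * spectralNorm2 (A ω))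
        ≤ Real.exp (l * ∑ i, ∑ j, c i * d j * A ω i j) := by gcongr
      _ ≤ ∑ d ∈ t, Real.exp (l * ∑ i, ∑ j, c i * d j * A ω i j) :=
          Finset.single_le_sum
            (f := fun d : EuclideanSpace ℝ (Fin n) => Real.exp (l * ∑ i, ∑ j, c i * d j * A ω i j))
            (fun _ _ => (Real.exp_pos _).le) hd
      _ ≤ F ω := Finset.single_le_sum
          (f := fun c : EuclideanSpace ℝ (Fin m) =>
            ∑ d ∈ t, Real.exp (l * ∑ i, ∑ j, c i * d j * A ω i j))
          (fun _ _ => Finset.sum_nonneg fun _ _ => (Real.exp_pos _).le) hc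
  have hFint : Integrable F P := integrable_finsetSum _ fun c hc => integrable_finsetSum _
    fun d hd => (integral_exp_bilinear_le hind hsub (hs2 c hc) (ht2 d hd) l).1
  have hFle : ∫ ω, F ω ∂P ≤ Real.exp a := by
    rw [hF, integral_finsetSum _ fun c hc => integrable_finsetSum _
      fun d hd => (integral_exp_bilinear_le hind hsub (hs2 c hc) (ht2 d hd) l).1]
    have h1 : ∀ c ∈ s, ∫ ω, ∑ d ∈ t, Real.exp (l * ∑ i, ∑ j, c i * d j * A ω i j) ∂P ≤
        t.card * Real.exp (320 * n) := by
      intro c hc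
      rw [integral_finsetSum _ fun d hd =>
        (integral_exp_bilinear_le hind hsub (hs2 c hc) (ht2 d hd) l).1, ← nsmul_eq_mul]
      refine Finset.sum_le_card_nsmul _ _ _ fun d hd => ?_
      refine (integral_exp_bilinear_le hind hsub (hs2 c hc) (ht2 d hd) l).2.trans_eq ?_
      rw [← hl2]
      ring_nf
    have h5 : (5 : ℝ) ^ n ≤ Real.exp (2 * n) := by
      have h6 : (5 : ℝ) ≤ Real.exp 2 := by
        have := Real.quadratic_le_exp_of_nonneg (x := 2) (by norm_num)
        linarith
      rw [mul_comm, Real.exp_nat_mul]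
      gcongr
    have hsc : (s.card : ℝ) ≤ 5 ^ n := by
      exact_mod_cast hscard.trans (Nat.pow_le_pow_right (by norm_num) hmn)
    have htc : (t.card : ℝ) ≤ 5 ^ n := by exact_mod_cast htcard
    calc ∑ c ∈ s, ∫ ω, ∑ d ∈ t, Real.exp (l * ∑ i, ∑ j, c i * d j * A ω i j) ∂P
        ≤ s.card * (t.card * Real.exp (320 * n)) := by
          rw [← nsmul_eq_mul]
          exact Finset.sum_le_card_nsmul _ _ _ h1
      _ ≤ Real.exp (2 * n) * (Real.exp (2 * n) * Real.exp (320 * n)) := by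
          gcongr
          · exact hsc.trans h5
          · exact htc.trans h5
      _ = Real.exp a := by rw [← Real.exp_add, ← Real.exp_add, ha]; ring_nf
  have ha1 : 1 ≤ a := by rw [ha]; linarith
  have hpt : ∀ ω, spectralNorm2 (A ω) ^ 2 ≤
      (l ^ 2)⁻¹ * (a ^ 2 + 4 * a * (Real.exp (-a) * F ω)) := by
    intro ω
    rw [← div_eq_inv_mul, le_div_iff₀ (by positivity), mul_comm, ← mul_pow]
    refine (sq_le_sq_add_exp ha1 (mul_nonneg hlpos.le (hW0 ω))).trans ?_
    gcongr
    rw [sub_eq_add_neg, Real.exp_add, mul_comm]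
    gcongr
    exact hexp ω
  have hGint : Integrable (fun ω => (l ^ 2)⁻¹ * (a ^ 2 + 4 * a * (Real.exp (-a) * F ω))) P :=
    ((integrable_const _).add ((hFint.const_mul _).const_mul _)).const_mul _
  have hint : Integrable (fun ω => spectralNorm2 (A ω) ^ 2) P := by
    refine hGint.mono' (hWmeas.pow_const 2).aestronglyMeasurable (ae_of_all _ fun ω => ?_)
    rw [Real.norm_of_nonneg (sq_nonneg _)]
    exact hpt ω
  refine ⟨hint, (integral_mono hint hGint hpt).trans ?_⟩
  rw [integral_const_mul, integral_add (integrable_const _) ((hFint.const_mul _).const_mul _),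
    integral_const_mul, integral_const_mul]
  simp only [integral_const, probReal_univ, one_smul]
  have h7 : Real.exp (-a) * ∫ ω, F ω ∂P ≤ 1 := by
    calc Real.exp (-a) * ∫ ω, F ω ∂P ≤ Real.exp (-a) * Real.exp a := by gcongr
      _ = 1 := by rw [← Real.exp_add]; simp
  calc (l ^ 2)⁻¹ * (a ^ 2 + 4 * a * (Real.exp (-a) * ∫ ω, F ω ∂P))
      ≤ (l ^ 2)⁻¹ * (a ^ 2 + 4 * a * 1) := by gcongr
    _ ≤ (l ^ 2)⁻¹ * (5 * a ^ 2) := by gcongr; nlinarith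
    _ = 5 * 324 ^ 2 * σ ^ 2 * n := by
        rw [ha, ← div_eq_inv_mul, div_eq_iff (by positivity)]
        linear_combination (-(5 * 324 ^ 2 * (n : ℝ))) * hl2

/-! ### Partially observed matrices -/

/-- The partially observed matrix: the entry `X i j` is seen where `D i j` is true. -/
def maskedMatrix {Ω : Type*} {m n : ℕ} (X : Matrix (Fin m) (Fin n) (Ω → ℝ))
    (D : Matrix (Fin m) (Fin n) (Ω → Bool)) (ω : Ω) : Matrix (Fin m) (Fin n) (Option ℝ) :=
  Matrix.of fun i j => if D i j ω = true then some (X i j ω) else none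

theorem zeroFill_maskedMatrix {Ω : Type*} {m n : ℕ} (X : Matrix (Fin m) (Fin n) (Ω → ℝ))
    (D : Matrix (Fin m) (Fin n) (Ω → Bool)) (ω : Ω) (i : Fin m) (j : Fin n) :
    zeroFill (maskedMatrix X D ω) i j = if D i j ω = true then X i j ω else 0 := by
  by_cases h : D i j ω = true <;> simp [zeroFill, maskedMatrix, h]

theorem observedProportion_maskedMatrix {Ω : Type*} {m n : ℕ}
    (X : Matrix (Fin m) (Fin n) (Ω → ℝ)) (D : Matrix (Fin m) (Fin n) (Ω → Bool)) (ω : Ω) :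
    observedProportion (maskedMatrix X D ω) =
      max ((Finset.univ.filter fun q : Fin m × Fin n => D q.1 q.2 ω = true).card : ℝ) 1 /
        ((m : ℝ) * n) := by
  have h : ∀ i j, (maskedMatrix X D ω i j).isSome = D i j ω := by
    intro i j
    by_cases h : D i j ω = true <;> simp [maskedMatrix, h]
  rw [observedProportion, max_div_div_right (by positivity)]
  simp_rw [h]
  congr 2
  rw [Finset.card_filter, Fintype.sum_prod_type]
  push_cast
  rfl

namespace IsImputable

variable {Ω : Type*} [MeasurableSpace Ω] {P : Measure Ω} {m n : ℕ}
  {X : Matrix (Fin m) (Fin n) (Ω → ℝ)} {D : Matrix (Fin m) (Fin n) (Ω → Bool)}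
  {M : Matrix (Fin m) (Fin n) ℝ} {σ p δ₁ : ℝ} {r : ℕ}

/-- A nonpositive noise level forces the means of all entries to vanish. -/
theorem noise_pos [IsProbabilityMeasure P]
    (h : IsImputable P X D M σ p r δ₁) (hM : 0 < frobeniusSq M) : 0 < σ := by
  by_contra! hσ
  have h0 : ∀ i j, M i j = 0 := by
    intro i j
    have h1 : ∀ t : ℝ, 0 < t → |M i j| ≤ t := by
      intro t ht
      obtain ⟨h2, h3⟩ := integrable_exp_sq_div (h.measurable_entry i j) (fun _ => le_rfl)
        (lintegral_exp_le_two_of_psi2Norm_le (h.subgaussian i j) ht (hσ.trans_lt ht))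
      have h4 := (memLp_two_and_sq_integral_le (h.measurable_entry i j) ht h2 h3).2
      rw [h.mean_entry] at h4
      exact abs_le_of_sq_le_sq h4 ht.le
    exact abs_nonpos_iff.1 (le_of_forall_gt_imp_ge_of_dense h1)
  simp [frobeniusSq, h0] at hM

theorem measurable_zeroFill (h : IsImputable P X D M σ p r δ₁) (i : Fin m) (j : Fin n) :
    Measurable fun ω => if D i j ω = true then X i j ω else 0 :=
  Measurable.ite (h.measurable_obs i j (measurableSet_singleton true)) (h.measurable_entry i j)
    measurable_const

theorem integral_zeroFill (h : IsImputable P X D M σ p r δ₁) (i : Fin m) (j : Fin n) :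
    ∫ ω, (if D i j ω = true then X i j ω else 0) ∂P = p * M i j := by
  have hf : Measurable fun b : Bool => if b = true then (1 : ℝ) else 0 := measurable_of_finite _
  have h1 := ((h.indep_obs i j).comp measurable_id hf).integral_fun_mul_eq_mul_integral
    (h.measurable_entry i j).aestronglyMeasurable
    (hf.comp (h.measurable_obs i j)).aestronglyMeasurable
  simp only [Function.comp_apply, id] at h1
  have h2 : ∫ ω, (if D i j ω = true then (1 : ℝ) else 0) ∂P = p := by
    have h3 : (fun ω => if D i j ω = true then (1 : ℝ) else 0) =
        {ω | D i j ω = true}.indicator fun _ => 1 := by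
      ext ω
      simp [Set.indicator_apply]
    have hset : MeasurableSet {ω | D i j ω = true} :=
      h.measurable_obs i j (measurableSet_singleton true)
    rw [h3, integral_indicator_const _ hset, measureReal_def, h.prob_obs,
      ENNReal.toReal_ofReal h.p_pos.le]
    simp
  rw [h2, h.mean_entry] at h1
  rw [mul_comm, ← h1]
  congr 1
  ext ω
  simp

theorem integral_spectralNorm2_sq_le [IsProbabilityMeasure P]
    (h : IsImputable P X D M σ p r δ₁) (hmn : m ≤ n)
    (hn : 0 < n) (hσ : 0 < σ) :
    Integrable (fun ω => spectralNorm2 (zeroFill (maskedMatrix X D ω) - p • M) ^ 2) P ∧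
      ∫ ω, spectralNorm2 (zeroFill (maskedMatrix X D ω) - p • M) ^ 2 ∂P ≤
        5 * 324 ^ 2 * σ ^ 2 * n := by
  have hentry : ∀ ω i j, (zeroFill (maskedMatrix X D ω) - p • M) i j =
      (if D i j ω = true then X i j ω else 0) - p * M i j := by
    intro ω i j
    simp [zeroFill_maskedMatrix]
  refine _root_.integral_spectralNorm2_sq_le hmn hn ?_ ?_ hσ ?_ <;> simp_rw [hentry]
  · exact fun i j => (h.measurable_zeroFill i j).sub_const _
  · refine h.indep.comp (fun q x => (if x.2 = true then x.1 else 0) - p * M q.1 q.2) fun q => ?_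
    exact (Measurable.ite (measurable_snd (measurableSet_singleton true)) measurable_fst
      measurable_const).sub_const _
  · intro i j
    rw [← h.integral_zeroFill i j]
    refine hasSubgaussianMGF_sub_integral (X := X i j) (h.measurable_zeroFill i j)
      (fun ω => ?_) (by positivity)
      (lintegral_exp_le_two_of_psi2Norm_le (h.subgaussian i j) (by positivity) (by linarith))
    split_ifs
    · exact le_rfl
    · simpa using sq_nonneg (X i j ω)

theorem integral_comp_observedProportion [IsProbabilityMeasure P]
    (h : IsImputable P X D M σ p r δ₁) (g : ℝ → ℝ) :
    ∫ ω, g (observedProportion (maskedMatrix X D ω)) ∂P =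
      binomMean (m * n) p (fun k => g (max (k : ℝ) 1 / ((m : ℝ) * n))) := by
  simp_rw [observedProportion_maskedMatrix]
  have hind : iIndepFun (fun (q : Fin m × Fin n) ω => D q.1 q.2 ω) P :=
    h.indep.comp (fun _ x => x.2) fun _ => measurable_snd
  have := integral_card_filter_eq_binomMean (fun q : Fin m × Fin n => h.measurable_obs q.1 q.2)
    hind h.p_pos.le (fun q => h.prob_obs q.1 q.2) fun k => g (max (k : ℝ) 1 / ((m : ℝ) * n))
  simpa using this

theorem integrable_comp_observedProportion [IsProbabilityMeasure P]
    (h : IsImputable P X D M σ p r δ₁) (g : ℝ → ℝ) :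
    Integrable (fun ω => g (observedProportion (maskedMatrix X D ω))) P := by
  simp_rw [observedProportion_maskedMatrix]
  have hS : Measurable fun ω =>
      (fun q : Fin m × Fin n => D q.1 q.2 ω) :=
    measurable_pi_lambda _ fun q => h.measurable_obs q.1 q.2
  have hG : Measurable fun b : Fin m × Fin n → Bool =>
      g (max ((Finset.univ.filter fun q => b q = true).card : ℝ) 1 / ((m : ℝ) * n)) :=
    measurable_of_finite _
  obtain ⟨C, hC⟩ := (Set.finite_range fun b : Fin m × Fin n → Bool =>
      ‖g (max ((Finset.univ.filter fun q => b q = true).card : ℝ) 1 / ((m : ℝ) * n))‖).bddAbove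
  exact Integrable.of_bound (hG.comp hS).aestronglyMeasurable C
    (ae_of_all _ fun ω => hC ⟨fun q => D q.1 q.2 ω, rfl⟩)

/-- The two parts of the bound come from the approximating matrix of rank at most `r` and from
the remainder, whose rank is at most `m` and whose entries are at most `δ₁`. -/
theorem nuclearNorm_smul_le (h : IsImputable P X D M σ p r δ₁) :
    nuclearNorm (p • M) ≤ p * (Real.sqrt r * Real.sqrt (frobeniusSq M) +
      (Real.sqrt r + Real.sqrt m) * (Real.sqrt (m * n) * δ₁)) := by
  obtain ⟨Mr, hrank, hMr⟩ := h.low_rank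
  have hp := h.p_pos
  have hE : Real.sqrt (frobeniusSq (M - Mr)) ≤ Real.sqrt (m * n) * δ₁ := by
    rw [← Real.sqrt_sq h.delta_nonneg, ← Real.sqrt_mul (by positivity)]
    exact Real.sqrt_le_sqrt (frobeniusSq_le_of_abs_le hMr)
  have hB : Real.sqrt (frobeniusSq Mr) ≤
      Real.sqrt (frobeniusSq M) + Real.sqrt (m * n) * δ₁ := by
    have := sqrt_frobeniusSq_sub_le M (M - Mr)
    rw [sub_sub_cancel] at this
    linarith
  have hsmul : ∀ B : Matrix (Fin m) (Fin n) ℝ,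
      Real.sqrt (frobeniusSq (p • B)) = p * Real.sqrt (frobeniusSq B) := by
    intro B
    rw [frobeniusSq_smul, Real.sqrt_mul (sq_nonneg p), Real.sqrt_sq hp.le]
  have hr1 : ((p • Mr).rank : ℝ) ≤ r := by
    have : (p • Mr).rank ≤ Mr.rank := by
      have h1 : p • Mr = (p • (1 : Matrix (Fin m) (Fin m) ℝ)) * Mr := by simp
      rw [h1]
      exact Matrix.rank_mul_le_right _ _
    exact_mod_cast this.trans hrank
  have hr2 : ((p • (M - Mr)).rank : ℝ) ≤ m := by
    exact_mod_cast (Matrix.rank_le_card_height _).trans_eq (Fintype.card_fin m)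
  refine (nuclearNorm_le (p • M) (p • Mr)).trans ?_
  rw [← smul_sub, hsmul, hsmul]
  calc Real.sqrt ((p • Mr).rank : ℝ) * (p * Real.sqrt (frobeniusSq Mr)) +
        Real.sqrt ((p • (M - Mr)).rank : ℝ) * (p * Real.sqrt (frobeniusSq (M - Mr)))
      ≤ Real.sqrt r * (p * (Real.sqrt (frobeniusSq M) + Real.sqrt (m * n) * δ₁)) +
        Real.sqrt m * (p * (Real.sqrt (m * n) * δ₁)) := by gcongr
    _ = _ := by ring

/-- The mean-squared error of an estimator with the estimation guarantee. The error splits as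
`M̂ - M = p̂⁻¹ (p̂ M̂ - p M) + (p / p̂ - 1) M`, and the product `p̂⁻² ‖Y - p M‖` is separated by the
inequality of arithmetic and geometric means at the scale `σ √n` of the spectral norm. -/
theorem lintegral_frobeniusSq_sub_le [IsProbabilityMeasure P]
    (h : IsImputable P X D M σ p r δ₁) (hm : 0 < m)
    (hmn : m ≤ n) (hσ : 0 < σ) (hnp : 1 ≤ n * p) {C₀ : ℝ} (hC₀ : 0 < C₀)
    {ME : MatrixEstimator m n}
    (hME : ∀ᵐ ω ∂P, frobeniusSq (observedProportion (maskedMatrix X D ω) •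
        ME (maskedMatrix X D ω) - p • M) ≤
      C₀ * spectralNorm2 (zeroFill (maskedMatrix X D ω) - p • M) * nuclearNorm (p • M)) :
    ∫⁻ ω, ENNReal.ofReal (frobeniusSq (ME (maskedMatrix X D ω) - M)) ∂P ≤
      ENNReal.ofReal (525000 * C₀ * σ / p * Real.sqrt n *
          (Real.sqrt r * Real.sqrt (frobeniusSq M) +
            (Real.sqrt r + Real.sqrt m) * (Real.sqrt (m * n) * δ₁)) +
        60 * (1 - p) / (m * n * p) * frobeniusSq M) := by
  have hp := h.p_pos
  have hn : 0 < n := hm.trans_le hmn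
  have hm' : (1 : ℝ) ≤ m := by exact_mod_cast hm
  have hn' : (1 : ℝ) ≤ n := by exact_mod_cast hn
  have hmnp : 1 ≤ ((m * n : ℕ) : ℝ) * p := by
    push_cast
    rw [mul_assoc]
    exact one_le_mul_of_one_le_of_one_le hm' hnp
  set κ : ℝ := σ * Real.sqrt n with hκ
  have hκpos : 0 < κ := by positivity
  have hκ2 : κ ^ 2 = σ ^ 2 * n := by rw [hκ, mul_pow, Real.sq_sqrt (by positivity)]
  set ph : Ω → ℝ := fun ω => observedProportion (maskedMatrix X D ω) with hph
  set W : Ω → ℝ := fun ω => spectralNorm2 (zeroFill (maskedMatrix X D ω) - p • M) with hW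
  set ν := nuclearNorm (p • M) with hν
  have hν0 : 0 ≤ ν := Finset.sum_nonneg fun _ _ => Real.sqrt_nonneg _
  obtain ⟨hWint, hWle⟩ := h.integral_spectralNorm2_sq_le hmn hn hσ
  have hphpos : ∀ ω, 0 < ph ω := by
    intro ω
    simp only [hph, observedProportion_maskedMatrix]
    have : (0 : ℝ) < max ((Finset.univ.filter fun q : Fin m × Fin n =>
      D q.1 q.2 ω = true).card : ℝ) 1 := lt_max_of_lt_right one_pos
    positivity
  have hinvint : Integrable (fun ω => (ph ω)⁻¹ ^ 4) P :=
    h.integrable_comp_observedProportion fun x => x⁻¹ ^ 4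
  have hinv : ∫ ω, (ph ω)⁻¹ ^ 4 ∂P ≤ 120 / p ^ 4 := by
    have h1 := h.integral_comp_observedProportion fun x => x⁻¹ ^ 4
    have h2 : binomMean (m * n) p (fun k => (max (k : ℝ) 1 / ((m : ℝ) * n))⁻¹ ^ 4) =
        ((m : ℝ) * n) ^ 4 * binomMean (m * n) p (fun k => 1 / max (k : ℝ) 1 ^ 4) := by
      rw [← binomMean_const_mul]
      congr 1
      ext k
      rw [inv_div, div_pow, mul_one_div]
    rw [h2] at h1
    refine h1.trans_le ?_
    calc ((m : ℝ) * n) ^ 4 * binomMean (m * n) p (fun k => 1 / max (k : ℝ) 1 ^ 4)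
        ≤ ((m : ℝ) * n) ^ 4 * (120 / (((m * n : ℕ) : ℝ) * p) ^ 4) := by
          gcongr
          exact binomMean_inv_max_pow_four_le (by positivity) hp h.p_le_one
      _ = 120 / p ^ 4 := by
          push_cast
          field_simp
  have hrelint : Integrable (fun ω => ((p - ph ω) / ph ω) ^ 2) P :=
    h.integrable_comp_observedProportion fun x => ((p - x) / x) ^ 2
  have hrel : ∫ ω, ((p - ph ω) / ph ω) ^ 2 ∂P ≤ 30 * (1 - p) / (m * n * p) := by
    have h1 := h.integral_comp_observedProportion fun x => ((p - x) / x) ^ 2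
    have h2 := binomMean_relative_error_le hp h.p_le_one hmnp
    push_cast at h2
    refine h1.trans_le (le_trans (le_of_eq ?_) h2)
    congr 1
    ext k
    have : (0 : ℝ) < max (k : ℝ) 1 := lt_max_of_lt_right one_pos
    field_simp
  set G : Ω → ℝ := fun ω => C₀ * ν * (κ * p ^ 2 * (ph ω)⁻¹ ^ 4 + (κ * p ^ 2)⁻¹ * W ω ^ 2) +
    2 * frobeniusSq M * ((p - ph ω) / ph ω) ^ 2 with hG
  have hi1 : Integrable (fun ω => C₀ * ν * (κ * p ^ 2 * (ph ω)⁻¹ ^ 4 +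
      (κ * p ^ 2)⁻¹ * W ω ^ 2)) P :=
    ((hinvint.const_mul _).add (hWint.const_mul _)).const_mul _
  have hi2 : Integrable (fun ω => 2 * frobeniusSq M * ((p - ph ω) / ph ω) ^ 2) P :=
    hrelint.const_mul _
  have hGint : Integrable G P := hi1.add hi2
  have hF0 := frobeniusSq_nonneg M
  have hG0 : ∀ ω, 0 ≤ G ω := by
    intro ω
    have := (hphpos ω).le
    simp only [hG]
    positivity
  have hpt : ∀ᵐ ω ∂P, frobeniusSq (ME (maskedMatrix X D ω) - M) ≤ G ω := by
    filter_upwards [hME] with ω hω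
    have hpos := hphpos ω
    have hdecomp : ME (maskedMatrix X D ω) - M =
        (ph ω)⁻¹ • (ph ω • ME (maskedMatrix X D ω) - p • M) + ((p - ph ω) / ph ω) • M := by
      ext i j
      simp only [Matrix.sub_apply, Matrix.add_apply, Matrix.smul_apply, smul_eq_mul]
      field_simp
      ring
    rw [hdecomp]
    refine (frobeniusSq_add_le _ _).trans ?_
    rw [frobeniusSq_smul, frobeniusSq_smul]
    have hamgm : 2 * ((ph ω)⁻¹ ^ 2 * W ω) ≤
        κ * p ^ 2 * (ph ω)⁻¹ ^ 4 + (κ * p ^ 2)⁻¹ * W ω ^ 2 := by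
      have hc : 0 < κ * p ^ 2 := by positivity
      have h1 : 0 ≤ (κ * p ^ 2)⁻¹ * (κ * p ^ 2 * (ph ω)⁻¹ ^ 2 - W ω) ^ 2 := by positivity
      have h2 : (κ * p ^ 2)⁻¹ * (κ * p ^ 2 * (ph ω)⁻¹ ^ 2 - W ω) ^ 2 =
          κ * p ^ 2 * (ph ω)⁻¹ ^ 4 + (κ * p ^ 2)⁻¹ * W ω ^ 2 - 2 * ((ph ω)⁻¹ ^ 2 * W ω) := by
        field_simp
        ring
      linarith
    have h3 : 2 * ((ph ω)⁻¹ ^ 2 * frobeniusSq (ph ω • ME (maskedMatrix X D ω) - p • M)) ≤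
        C₀ * ν * (2 * ((ph ω)⁻¹ ^ 2 * W ω)) := by
      calc _ ≤ 2 * ((ph ω)⁻¹ ^ 2 * (C₀ * W ω * ν)) := by gcongr
        _ = _ := by ring
    have h4 : C₀ * ν * (2 * ((ph ω)⁻¹ ^ 2 * W ω)) ≤
        C₀ * ν * (κ * p ^ 2 * (ph ω)⁻¹ ^ 4 + (κ * p ^ 2)⁻¹ * W ω ^ 2) := by gcongr
    simp only [hG]
    linarith
  -- `ME` need not be measurable; its error is dominated by the integrable function `G`
  calc ∫⁻ ω, ENNReal.ofReal (frobeniusSq (ME (maskedMatrix X D ω) - M)) ∂P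
      ≤ ∫⁻ ω, ENNReal.ofReal (G ω) ∂P :=
        lintegral_mono_ae (hpt.mono fun ω hω => ENNReal.ofReal_le_ofReal hω)
    _ = ENNReal.ofReal (∫ ω, G ω ∂P) :=
        (ofReal_integral_eq_lintegral_ofReal hGint (ae_of_all _ hG0)).symm
    _ ≤ _ := by
        refine ENNReal.ofReal_le_ofReal ?_
        simp only [hG]
        rw [integral_add hi1 hi2, integral_const_mul, integral_const_mul,
          integral_add (hinvint.const_mul _) (hWint.const_mul _), integral_const_mul,
          integral_const_mul]
        refine add_le_add ?_ ?_
        · have hνle := h.nuclearNorm_smul_le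
          set R := Real.sqrt r * Real.sqrt (frobeniusSq M) +
            (Real.sqrt r + Real.sqrt m) * (Real.sqrt (m * n) * δ₁)
          calc C₀ * ν * (κ * p ^ 2 * ∫ ω, (ph ω)⁻¹ ^ 4 ∂P + (κ * p ^ 2)⁻¹ * ∫ ω, W ω ^ 2 ∂P)
              ≤ C₀ * ν * (κ * p ^ 2 * (120 / p ^ 4) +
                  (κ * p ^ 2)⁻¹ * (5 * 324 ^ 2 * σ ^ 2 * n)) := by gcongr
            _ = 525000 * C₀ * κ / p ^ 2 * ν := by
                have : 5 * 324 ^ 2 * σ ^ 2 * n = 5 * 324 ^ 2 * κ ^ 2 := by rw [hκ2]; ring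
                rw [this]
                field_simp
                ring
            _ ≤ 525000 * C₀ * κ / p ^ 2 * (p * R) := by gcongr
            _ = 525000 * C₀ * σ / p * Real.sqrt n * R := by
                rw [hκ]
                field_simp
        · calc 2 * frobeniusSq M * ∫ ω, ((p - ph ω) / ph ω) ^ 2 ∂P
              ≤ 2 * frobeniusSq M * (30 * (1 - p) / (m * n * p)) := by gcongr
            _ = _ := by ring

end IsImputable

/-! ### Page matrices -/

theorem pageTime_injective {L N : ℕ} :
    Function.Injective fun q : Fin L × Fin N => pageTime q.1 q.2 := by
  rintro ⟨i, j⟩ ⟨i', j'⟩ h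
  simp only [pageTime] at h
  have h1 : (i : ℕ) + j * L = i' + j' * L := by
    have h2 : ((i : ℕ) : ℤ) + (j : ℕ) * L = (i' : ℕ) + (j' : ℕ) * L := by linarith
    exact_mod_cast h2
  have hL : 0 < L := i.pos
  have hi : (i : ℕ) = i' := by
    have := congrArg (· % L) h1
    simpa [Nat.add_mul_mod_self_right, Nat.mod_eq_of_lt i.2, Nat.mod_eq_of_lt i'.2] using this
  have hj : (j : ℕ) = j' := by
    rw [hi] at h1
    exact Nat.eq_of_mul_eq_mul_right hL (Nat.add_left_cancel h1)
  exact Prod.ext (Fin.ext hi) (Fin.ext hj)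

theorem seriesOfPage_pageTime {L N : ℕ} (A : Matrix (Fin L) (Fin N) ℝ) (i : Fin L) (j : Fin N) :
    seriesOfPage A (pageTime i j) = A i j := by
  have h : seriesOfPage A (pageTime i j) =
      ∑ q : Fin L × Fin N, if pageTime i j = pageTime q.1 q.2 then A q.1 q.2 else 0 := by
    rw [seriesOfPage, Fintype.sum_prod_type]
  rw [h, Finset.sum_eq_single (i, j)]
  · simp
  · intro q _ hq
    rw [if_neg fun h => hq (pageTime_injective h).symm]
  · simp

theorem seriesNormSq_eq_frobeniusSq {L N : ℕ} (g : ℤ → ℝ) :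
    seriesNormSq L N g = frobeniusSq (pageMatrix L N g) := by
  have h : frobeniusSq (pageMatrix L N g) =
      ∑ q : Fin L × Fin N, g (pageTime q.1 q.2) ^ 2 := by
    rw [frobeniusSq, Fintype.sum_prod_type]
    rfl
  rw [h, seriesNormSq]
  symm
  refine Finset.sum_nbij (fun q => pageTime q.1 q.2) ?_ pageTime_injective.injOn ?_
    fun _ _ => rfl
  · rintro ⟨i, j⟩ -
    have h1 : (i : ℕ) + j * L + 1 ≤ L * N := by
      have := i.2
      have h2 : ((j : ℕ) + 1) * L ≤ N * L := Nat.mul_le_mul_right _ j.2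
      rw [mul_comm L N]
      linarith [add_mul (j : ℕ) 1 L]
    simp only [pageTime, Finset.mem_Icc]
    exact ⟨le_add_of_nonneg_left (by positivity), by exact_mod_cast h1⟩
  · intro t ht
    obtain ⟨h1, h2⟩ := Finset.mem_Icc.1 (Finset.mem_coe.1 ht)
    obtain ⟨k, hk⟩ := Int.eq_ofNat_of_zero_le (by linarith : 0 ≤ t - 1)
    have hkL : k < L * N := by
      have : (k : ℤ) < L * N := by linarith
      exact_mod_cast this
    have hL : 0 < L := Nat.pos_of_ne_zero fun h => by simp [h] at hkL
    refine ⟨(⟨k % L, Nat.mod_lt _ hL⟩, ⟨k / L, Nat.div_lt_of_lt_mul hkL⟩), by simp, ?_⟩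
    simp only [pageTime]
    have h3 : ((k % L : ℕ) : ℤ) + ((k / L : ℕ) : ℤ) * L = k := by
      exact_mod_cast Nat.mod_add_div' k L
    rw [h3]
    linarith

theorem mainTheorem1 :
    ∀ C₀ : ℝ, 0 < C₀ →
      ∃ C₁ C₂ C₃ c₄ : ℝ, 0 < C₁ ∧ 0 < C₂ ∧ 0 < C₃ ∧ 0 < c₄ ∧
        ∀ (Ω : Type*) [MeasurableSpace Ω] (P : Measure Ω) [IsProbabilityMeasure P]
          (T L N : ℕ) (_ : 1 < L) (_ : N = T / L - 1) (_ : L ≤ N)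
          (f : ℤ → ℝ) (_ : 0 < seriesNormSq L N f)
          (X : ℤ → Ω → ℝ) (D : ℤ → Ω → Bool)
          (σ p δ₁ ζ : ℝ) (r : ℕ)
          (_ : IsImputable P (pageMatrix L N X) (pageMatrix L N D) (pageMatrix L N f) σ p r δ₁)
          (_ : 0 < ζ) (_ : ζ < 1) (_ : ((max L N : ℕ) : ℝ) ^ (-1 + ζ) ≤ p)
          (ME : MatrixEstimator L N)
          (_ : EstimationGuarantee P ME (fun ω => pageMatrix L N (observedSeries X D ω))
            (pageMatrix L N f) p C₀ ζ),
          relMSE P L N (fun ω => imputedSeries ME (observedSeries X D ω)) f ≤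
            ENNReal.ofReal
              (C₁ * σ / p *
                  ((L : ℝ) * N * δ₁ / seriesNormSq L N f
                    + Real.sqrt ((r : ℝ) * L) * N * δ₁ / seriesNormSq L N f
                    + Real.sqrt ((r : ℝ) * N) / Real.sqrt (seriesNormSq L N f))
                + C₂ * (1 - p) / (p * L * N)
                + C₃ * Real.exp (-(c₄ * N))) := by
  intro C₀ hC₀
  refine ⟨525000 * C₀, 60, 1, 1, by positivity, by norm_num, one_pos, one_pos, ?_⟩
  intro Ω _ P _ T L N hL _ hLN f hf X D σ p δ₁ ζ r h hζ _ hp ME hME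
  have hN : 0 < N := by omega
  have hp0 := h.p_pos
  have hnp : 1 ≤ N * p := by
    rw [max_eq_right hLN] at hp
    have hN1 : (1 : ℝ) ≤ N := by exact_mod_cast hN
    have h1 : (N : ℝ) ^ (-1 : ℝ) ≤ p :=
      (Real.rpow_le_rpow_of_exponent_le hN1 (by linarith)).trans hp
    rw [Real.rpow_neg_one, inv_le_iff_one_le_mul₀ (by positivity)] at h1
    linarith
  have hsub : ∀ ω, seriesNormSq L N
      (fun t => imputedSeries ME (observedSeries X D ω) t - f t) =
      frobeniusSq (ME (maskedMatrix (pageMatrix L N X) (pageMatrix L N D) ω) -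
        pageMatrix L N f) := by
    intro ω
    rw [seriesNormSq_eq_frobeniusSq]
    congr 1
    ext i j
    exact congrArg (· - f (pageTime i j)) (seriesOfPage_pageTime _ i j)
  have hfM := seriesNormSq_eq_frobeniusSq (L := L) (N := N) f
  have hbound := h.lintegral_frobeniusSq_sub_le (by omega) hLN (h.noise_pos (hfM ▸ hf)) hnp hC₀
    (hME hp)
  rw [← hfM] at hbound
  unfold relMSE
  simp_rw [hsub]
  set F := seriesNormSq L N f
  refine (ENNReal.div_le_div_right hbound _).trans ?_
  rw [← ENNReal.ofReal_div_of_pos hf]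
  refine ENNReal.ofReal_le_ofReal ?_
  have hL0 : (0 : ℝ) < L := by exact_mod_cast (by omega : 0 < L)
  have hN0 : (0 : ℝ) < N := by exact_mod_cast hN
  rw [div_le_iff₀ hf]
  -- the exponentially small term only adds slack
  have hexp : 0 ≤ 1 * Real.exp (-(1 * (N : ℝ))) * F := by positivity
  refine le_trans (le_of_eq ?_) (le_add_of_nonneg_right hexp |>.trans_eq (add_mul _ _ _).symm)
  have hF : Real.sqrt F ^ 2 = F := Real.sq_sqrt hf.le
  have hFpos : 0 < Real.sqrt F := Real.sqrt_pos.2 hf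
  have hLs : Real.sqrt L ^ 2 = L := Real.sq_sqrt hL0.le
  have hNs : Real.sqrt N ^ 2 = N := Real.sq_sqrt hN0.le
  rw [Real.sqrt_mul hL0.le, Real.sqrt_mul (Nat.cast_nonneg r), Real.sqrt_mul (Nat.cast_nonneg r)]
  have e1 : 60 * (1 - p) / (L * N * p) * F = 60 * (1 - p) / (p * L * N) * F := by
    rw [show (L : ℝ) * N * p = p * L * N by ring]
  have e2 : Real.sqrt r * Real.sqrt N / Real.sqrt F * F =
      Real.sqrt r * Real.sqrt N * Real.sqrt F := by
    rw [div_mul_eq_mul_div, div_eq_iff hFpos.ne', ← hF, Real.sqrt_sq hFpos.le]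
    ring
  rw [e1, add_mul _ _ F, mul_assoc (525000 * C₀ * σ / p) _ F, add_mul _ _ F, add_mul _ _ F, e2,
    div_mul_cancel₀ _ hf.ne', div_mul_cancel₀ _ hf.ne']
  linear_combination (525000 * C₀ * σ / p) *
    (δ₁ * (Real.sqrt r * Real.sqrt L * hNs + Real.sqrt L ^ 2 * hNs + N * hLs))
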